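/- Let $D$ be a finite directed multigraph (loops and multiple edges are allowed, and all edges are distinguishable) in which every vertex has in-degree two and out-degree two (a loop contributing one to each), and suppose that $D$ is Eulerian, i.e. has an Euler circuit. Here a circuit is a non-empty cyclic sequence of distinct edges, each ending at the vertex where the cyclically next one starts (cyclic rotations are identified, vertices may repeat), and an Euler circuit is a circuit using every edge. Let $C$ be any Euler circuit of $D$, and let $H=H(C)$ be its interlace graph: the simple graph on the vertex set of $D$ in which two distinct vertices $a,b$ are adjacent if and only if $C$ visits them in the cyclic order $\ldots a\ldots b\ldots a\ldots b\ldots$. For an edge $ab$ of a finite simple graph $G$, the pivot $G^{ab}$ is obtained from $G$ by toggling (edge to non-edge and vice versa) every pair $xy$ of vertices other than $a,b$ such that $x$ and $y$ lie in two different ones of the three classes: vertices adjacent to $a$ but not $b$; to $b$ but not $a$; to both $a$ and $b$. Let $q(G)=q(G;x)\in\mathbb{Z}[x]$ be the interlace polynomial, the unique map on finite simple graphs such that $q(G)=q(G-a)+q(G^{ab}-b)$ for every edge $ab$ of $G$, and $q(E_n)=x^n$ for the edgeless graph $E_n$ on $n$ vertices. Let $r(D;x)=\sum_k r_k(D)\,x^k$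 be the circuit partition polynomial, where $r_k(D)$ is the number of partitions of the edge set of $D$ into $k$ circuits, and let $m(D;x)=\frac{1}{x-1}\,r(D;x-1)$ be the Martin polynomial. Then $$q(H;x)=\frac{1}{x-1}\,r(D;x-1)=m(D;x),$$ and, equivalently, $x\,q(H;1+x)=r(D;x)$. -/

import Mathlib

open Polynomial

/-! ### The interlace polynomial of a finite simple graph -/

namespace Interlace

universe u

/-- `x` and `y` are vertices other than `a` and `b` that lie in two different ones of the three
classes "adjacent to `a` alone", "adjacent to `b` alone", "adjacent to both `a` and `b`". -/
def Distinguished {V : Type u} (G : SimpleGraph V) (a b x y : V) : Prop :=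
  (x ≠ a ∧ x ≠ b) ∧ (y ≠ a ∧ y ≠ b) ∧
    (G.Adj x a ∨ G.Adj x b) ∧ (G.Adj y a ∨ G.Adj y b) ∧
    ¬((G.Adj x a ↔ G.Adj y a) ∧ (G.Adj x b ↔ G.Adj y b))

/-- The pivot `G ^ {ab}`: toggle every pair of vertices distinguished by `a` and `b`. -/
def pivot {V : Type u} (G : SimpleGraph V) (a b : V) : SimpleGraph V where
  Adj x y := ¬(G.Adj x y ↔ Distinguished G a b x y)
  symm := ⟨by
    intro x y h
    rw [G.adj_comm y x]
    unfold Distinguished at *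
    grind⟩
  loopless := ⟨by
    intro x h
    simp [Distinguished] at h⟩

/-- The graph `G - a`. -/
abbrev del {V : Type u} (G : SimpleGraph V) (a : V) : SimpleGraph ({a}ᶜ : Set V) :=
  G.induce {a}ᶜ

open Classical in
/-- Reduction of a graph with `n` vertices: as long as there is an edge `ab`, replace `q(G)` by
`q(G - a) + q(G ^ {ab} - b)`; an edgeless graph with `n` vertices contributes `X ^ n`.
The result does not depend on the edges chosen, see `interlacePoly_of_adj`. -/
noncomputable def interlaceAux : ℕ → ∀ {V : Type u}, SimpleGraph V → ℤ[X]
  | 0, _, _ => 1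
  | n + 1, V, G =>
    if h : ∃ e : V × V, G.Adj e.1 e.2 then
      interlaceAux n (del G h.choose.1) +
        interlaceAux n (del (pivot G h.choose.1 h.choose.2) h.choose.2)
    else X ^ (n + 1)

/-- The interlace polynomial `q(G)` of a finite simple graph `G`, the unique map with
`q(G) = q(G - a) + q(G ^ {ab} - b)` for every edge `ab` of `G` and `q(E_n) = X ^ n`
(`interlacePoly_of_adj` and `interlacePoly_bot`). -/
noncomputable def interlacePoly {V : Type u} (G : SimpleGraph V) : ℤ[X] :=
  interlaceAux (Nat.card V) G

theorem adj_pivot {V : Type u} {G : SimpleGraph V} {a b x y : V} :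
    (pivot G a b).Adj x y ↔ ¬(G.Adj x y ↔ Distinguished G a b x y) := Iff.rfl

/-- On graphs with `n` vertices, isomorphic graphs have the same value. -/
def IsoInv (n : ℕ) : Prop :=
  ∀ {V W : Type u} [Finite V] [Finite W] (G : SimpleGraph V) (H : SimpleGraph W),
    Nat.card V = n → (G ≃g H) → interlaceAux n G = interlaceAux n H

/-- On graphs with `n + 1` vertices, the reduction may start with any edge `ab`. -/
def Reduces (n : ℕ) : Prop :=
  ∀ {V : Type u} [Finite V] (G : SimpleGraph V) (a b : V), Nat.card V = n + 1 → G.Adj a b →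
    interlaceAux (n + 1) G = interlaceAux n (del G a) + interlaceAux n (del (pivot G a b) b)

/-- The value at the subgraph of `G` induced by the complement of `S`. -/
noncomputable def qOff {V : Type u} (n : ℕ) (G : SimpleGraph V) (S : Set V) : ℤ[X] :=
  interlaceAux n (G.induce Sᶜ)

theorem qOff_congr {V : Type u} [Finite V] {n : ℕ} (hn : IsoInv.{u} n) (G H : SimpleGraph V)
    (S T : Set V) (e : V ≃ V) (hS : Nat.card (Sᶜ : Set V) = n) (hST : ∀ x, x ∈ S ↔ e x ∈ T)
    (hadj : ∀ x y, x ∉ S → y ∉ S → (G.Adj x y ↔ H.Adj (e x) (e y))) :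
    qOff n G S = qOff n H T := by
  refine hn _ _ hS ⟨e.subtypeEquiv (fun x => not_congr (hST x)), ?_⟩
  rintro ⟨x, hx⟩ ⟨y, hy⟩
  exact (hadj x y hx hy).symm

theorem qOff_reduce {V : Type u} [Finite V] {n : ℕ} (hn : IsoInv.{u} n) (hr : Reduces.{u} n)
    (G : SimpleGraph V) (S : Set V) (a b : V) (hS : Nat.card (Sᶜ : Set V) = n + 1)
    (ha : a ∉ S) (hb : b ∉ S) (hab : G.Adj a b) :
    qOff (n + 1) G S = qOff n G (insert a S) + qOff n (pivot G a b) (insert b S) := by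
  have hcard : ∀ c : (Sᶜ : Set V), Nat.card ({c}ᶜ : Set (Sᶜ : Set V)) = n := by
    intro c
    have := Set.ncard_add_ncard_compl ({c} : Set (Sᶜ : Set V))
    rw [Set.ncard_singleton, hS] at this
    rw [Nat.card_coe_set_eq]
    omega
  have key : ∀ (c : V) (hc : c ∉ S) (K : SimpleGraph V) (L : SimpleGraph (Sᶜ : Set V)),
      (∀ x y, L.Adj x y ↔ K.Adj x y) →
      interlaceAux n (del L ⟨c, hc⟩) = qOff n K (insert c S) := by
    intro c hc K L hKL
    refine hn _ _ (hcard _)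
      ⟨⟨fun x => ⟨x.1.1, ?_⟩, fun x => ⟨⟨x.1, ?_⟩, ?_⟩, ?_, ?_⟩, ?_⟩
    · rcases x with ⟨⟨x, hx⟩, hxc⟩
      have hxc' : x ≠ c := fun h => hxc (Subtype.ext h)
      simp only [Set.mem_compl_iff, Set.mem_insert_iff] at *
      tauto
    · have := x.2
      simp only [Set.mem_compl_iff, Set.mem_insert_iff] at *
      tauto
    · have := x.2
      simp only [Set.mem_compl_iff, Set.mem_singleton_iff, Subtype.mk.injEq,
        Set.mem_insert_iff] at *
      tauto
    · intro x; rfl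
    · intro x; rfl
    · rintro ⟨x, hx⟩ ⟨y, hy⟩
      exact (hKL x y).symm
  unfold qOff
  rw [hr (G.induce Sᶜ) ⟨a, ha⟩ ⟨b, hb⟩ hS hab, key a ha G _ (fun x y => Iff.rfl),
    key b hb (pivot G a b) _ ?_]
  · rfl
  · rintro ⟨x, hx⟩ ⟨y, hy⟩
    simp [adj_pivot, Distinguished]

theorem pivot_comm {V : Type u} (G : SimpleGraph V) (a b : V) : pivot G a b = pivot G b a := by
  ext x y
  simp only [adj_pivot, Distinguished]
  grind

theorem pivot_eq_self {V : Type u} (G : SimpleGraph V) (a b : V)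
    (h : ∀ c, G.Adj a c → c = b) : pivot G a b = G := by
  ext x y
  simp only [adj_pivot, Distinguished]
  have hx := h x
  have hy := h y
  rw [G.adj_comm] at hx hy
  grind

theorem pivot_adj_left {V : Type u} (G : SimpleGraph V) (a b x : V) :
    (pivot G a b).Adj a x ↔ G.Adj a x := by
  simp [adj_pivot, Distinguished]

theorem pivot_adj_right {V : Type u} (G : SimpleGraph V) (a b x : V) :
    (pivot G a b).Adj b x ↔ G.Adj b x := by
  simp [adj_pivot, Distinguished]

theorem pivot_adj_of_ne {V : Type u} (G : SimpleGraph V) (a b x y : V) (hxa : x ≠ a)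
    (hxb : x ≠ b) (hya : y ≠ a) (hyb : y ≠ b) : (pivot G a b).Adj x y ↔
      ¬(G.Adj x y ↔ ¬(G.Adj a x ∧ G.Adj b y ↔ G.Adj b x ∧ G.Adj a y)) := by
  simp only [adj_pivot, Distinguished, G.adj_comm a, G.adj_comm b, ne_eq, hxa, hxb, hya, hyb,
    not_false_eq_true, true_and]
  grind

theorem pivot_adj_third {V : Type u} (G : SimpleGraph V) (a b c x : V)
    (hac : G.Adj a c) (hbc : b ≠ c) (hxa : x ≠ a) (hxb : x ≠ b) :
    (pivot G a b).Adj c x ↔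
      ¬(G.Adj c x ↔ ¬(G.Adj b x ↔ G.Adj b c ∧ G.Adj a x)) := by
  rw [pivot_adj_of_ne G a b c x hac.ne' hbc.symm hxa hxb]
  grind

theorem toggle_identity (p ax ay bx ey cx cy bc : Prop) :
    (¬(¬(p ↔ ¬(ax ∧ ey ↔ bx ∧ ay)) ↔
      ¬(ax ∧ ¬(cy ↔ ¬(ey ↔ bc ∧ ay)) ↔ ¬(cx ↔ ¬(bx ↔ bc ∧ ax)) ∧ ay))) ↔
    ¬(p ↔ ¬(ax ∧ cy ↔ cx ∧ ay)) := by
  by_cases h1 : ax <;> by_cases h2 : ay <;> by_cases h3 : bc <;>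
    simp only [h1, h2, h3, true_and, false_and, iff_true, iff_false] <;>
    by_cases h4 : ey <;> by_cases h5 : bx <;> by_cases h6 : p <;> by_cases h7 : cx <;>
    by_cases h8 : cy <;> simp [h4, h5, h6, h7, h8]

theorem pivot_pivot {V : Type u} (G : SimpleGraph V) (a b c : V) (hab : G.Adj a b)
    (hac : G.Adj a c) (hbc : b ≠ c) (x y : V) (hxb : x ≠ b) (hxc : x ≠ c) (hyb : y ≠ b)
    (hyc : y ≠ c) : (pivot (pivot G a b) a c).Adj x y ↔ (pivot G a c).Adj x y := by
  by_cases hxa : x = a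
  · subst hxa; simp only [pivot_adj_left]
  by_cases hya : y = a
  · subst hya; simp only [SimpleGraph.adj_comm _ x, pivot_adj_left]
  rw [pivot_adj_of_ne _ a c x y hxa hxc hya hyc, pivot_adj_of_ne _ a c x y hxa hxc hya hyc,
    pivot_adj_of_ne _ a b x y hxa hxb hya hyb, pivot_adj_left, pivot_adj_left,
    pivot_adj_third G a b c x hac hbc hxa hxb, pivot_adj_third G a b c y hac hbc hya hyb]
  apply toggle_identity

theorem pivot_pivot_swap {V : Type u} [DecidableEq V] (G : SimpleGraph V) (a b c : V)
    (hab : G.Adj a b)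
    (hac : G.Adj a c) (hbc : b ≠ c) (x y : V) (hxa : x ≠ a) (hxb : x ≠ b) (hya : y ≠ a)
    (hyb : y ≠ b) : (pivot G a b).Adj x y ↔
      (pivot (pivot G a c) b a).Adj (Equiv.swap b c x) (Equiv.swap b c y) := by
  rw [pivot_comm _ b a]
  by_cases hxc : x = c
  · subst hxc
    rw [Equiv.swap_apply_right, pivot_adj_right]
    by_cases hyx : y = x
    · subst hyx
      simp
    rw [Equiv.swap_apply_of_ne_of_ne hyb hyx, pivot_adj_third G a x b y hab hbc.symm hya hyx,
      pivot_adj_third G a b x y hac hbc hya hyb, G.adj_comm x b]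
    grind
  by_cases hyc : y = c
  · subst hyc
    rw [Equiv.swap_apply_right, Equiv.swap_apply_of_ne_of_ne hxb hxc,
      SimpleGraph.adj_comm _ x b, pivot_adj_right, SimpleGraph.adj_comm _ x y,
      pivot_adj_third G a y b x hab hbc.symm hxa hxc,
      pivot_adj_third G a b y x hac hbc hxa hxb, G.adj_comm y b]
    grind
  rw [Equiv.swap_apply_of_ne_of_ne hxb hxc, Equiv.swap_apply_of_ne_of_ne hyb hyc,
    pivot_pivot G a c b hac hab hbc.symm x y hxc hxb hyc hyb]

theorem pivot_adj_far {V : Type u} (G : SimpleGraph V) (a b c x : V) (hac : ¬G.Adj a c)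
    (hbc : ¬G.Adj b c) : (pivot G a b).Adj x c ↔ G.Adj x c := by
  rw [G.adj_comm] at hac hbc
  simp only [adj_pivot, Distinguished]
  grind

theorem pivot_far {V : Type u} (G : SimpleGraph V) (a b c d : V)
    (hac : ¬G.Adj a c) (had : ¬G.Adj a d) (hbc : ¬G.Adj b c)
    (hbd : ¬G.Adj b d) : pivot (pivot G a b) c d = pivot (pivot G c d) a b := by
  have h1 : ∀ x y, Distinguished (pivot G a b) c d x y ↔ Distinguished G c d x y := by
    intro x y
    simp only [Distinguished, pivot_adj_far G a b c _ hac hbc, pivot_adj_far G a b d _ had hbd]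
  rw [G.adj_comm] at hac hbc had hbd
  have h2 : ∀ x y, Distinguished (pivot G c d) a b x y ↔ Distinguished G a b x y := by
    intro x y
    simp only [Distinguished, pivot_adj_far G c d a _ hac had, pivot_adj_far G c d b _ hbc hbd]
  ext x y
  rw [adj_pivot, adj_pivot, h1, adj_pivot, adj_pivot, h2]
  grind

theorem card_compl {V : Type u} [Finite V] {n : ℕ} (S : Set V) (a : V) (ha : a ∉ S)
    (hS : Nat.card (Sᶜ : Set V) = n + 1) : Nat.card ((insert a S)ᶜ : Set V) = n := by
  have h1 := Set.ncard_add_ncard_compl S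
  have h2 := Set.ncard_add_ncard_compl (insert a S)
  rw [Set.ncard_insert_of_notMem ha] at h2
  rw [Nat.card_coe_set_eq] at *
  omega

theorem reduces_succ {n : ℕ} (h0 : IsoInv.{u} n) (hr : Reduces.{u} n) : Reduces.{u} (n + 1) := by
  classical
  intro V _ G a₀ b₀ hV hab₀
  have hsing : ∀ a : V, Nat.card (({a} : Set V)ᶜ : Set V) = n + 1 := by
    intro a
    have := card_compl (n := n + 1) (∅ : Set V) a (by simp) (by simpa using hV)
    simpa using this
  have hpair : ∀ a b : V, a ≠ b → Nat.card (({a, b} : Set V)ᶜ : Set V) = n := by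
    intro a b hab
    exact card_compl _ _ (by simpa using hab) (hsing b)
  set F : V → V → ℤ[X] := fun a b => qOff (n + 1) G {a} + qOff (n + 1) (pivot G a b) {b} with hF
  have red : ∀ (K : SimpleGraph V) (s a b : V), s ≠ a → s ≠ b → K.Adj a b →
      qOff (n + 1) K {s} = qOff n K {a, s} + qOff n (pivot K a b) {b, s} := by
    intro K s a b ha hb hab
    exact qOff_reduce h0 hr K {s} a b (hsing s) (by simpa using ha.symm) (by simpa using hb.symm)
      hab
  have eqOff : ∀ (K L : SimpleGraph V) (a b : V), a ≠ b →
      (∀ x y, x ≠ a → x ≠ b → y ≠ a → y ≠ b → (K.Adj x y ↔ L.Adj x y)) →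
      qOff n K {a, b} = qOff n L {a, b} := by
    intro K L a b hab h
    refine qOff_congr h0 K L _ _ (Equiv.refl V) (hpair a b hab) (fun x => Iff.rfl) ?_
    intro x y hx hy
    simp only [Set.mem_insert_iff, Set.mem_singleton_iff, not_or] at hx hy
    exact h x y hx.1 hx.2 hy.1 hy.2
  have symF : ∀ a b, G.Adj a b → F a b = F b a := by
    intro a b hab
    by_cases ha : ∀ c, G.Adj a c → c = b
    · have h1 := pivot_eq_self G a b ha
      have h2 : pivot G b a = G := by rw [pivot_comm, h1]
      simp only [hF, h1, h2, add_comm]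
    by_cases hb : ∀ c, G.Adj b c → c = a
    · have h2 := pivot_eq_self G b a hb
      have h1 : pivot G a b = G := by rw [pivot_comm, h2]
      simp only [hF, h1, h2, add_comm]
    push Not at ha hb
    obtain ⟨c, hac, hcb⟩ := ha
    obtain ⟨d, hbd, hda⟩ := hb
    simp only [hF]
    rw [red G a b d hab.ne hda.symm hbd, red G b a c hab.ne' hcb.symm hac,
      red (pivot G a b) b a c hab.ne' hcb.symm ((pivot_adj_left ..).2 hac),
      red (pivot G b a) a b d hab.ne hda.symm ((pivot_adj_left ..).2 hbd),
      eqOff (pivot (pivot G a b) a c) (pivot G a c) c b hcb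
        (fun x y hxc hxb hyc hyb => pivot_pivot G a b c hab hac hcb.symm x y hxb hxc hyb hyc),
      eqOff (pivot (pivot G b a) b d) (pivot G b d) d a hda
        (fun x y hxc hxb hyc hyb => pivot_pivot G b a d hab.symm hbd hda.symm x y hxb hxc hyb hyc),
      pivot_comm G b a, Set.pair_comm b a]
    ring
  have stepF : ∀ a b c, G.Adj a b → G.Adj a c → F a b = F a c := by
    intro a b c hab hac
    by_cases hbc : b = c
    · rw [hbc]
    simp only [hF]
    have hsw : qOff n (pivot G a b) {a, b} = qOff n (pivot (pivot G a c) b a) {a, c} := by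
      refine qOff_congr h0 _ _ _ _ (Equiv.swap b c) (hpair a b hab.ne) ?_ ?_
      · intro x
        have h1 := hab.ne
        have h2 := hac.ne
        simp only [Set.mem_insert_iff, Set.mem_singleton_iff, Equiv.swap_apply_def]
        grind
      · intro x y hx hy
        simp only [Set.mem_insert_iff, Set.mem_singleton_iff, not_or] at hx hy
        exact pivot_pivot_swap G a b c hab hac hbc x y hx.1 hx.2 hy.1 hy.2
    rw [red (pivot G a b) b a c hab.ne' hbc ((pivot_adj_left ..).2 hac),
      red (pivot G a c) c b a (Ne.symm hbc) hac.ne'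
        (((pivot G a c).adj_comm _ _).1 ((pivot_adj_left ..).2 hab)),
      eqOff (pivot (pivot G a b) a c) (pivot G a c) c b (Ne.symm hbc)
        (fun x y hxc hxb hyc hyb => pivot_pivot G a b c hab hac hbc x y hxb hxc hyb hyc),
      hsw, Set.pair_comm b c]
    ring
  have farF : ∀ a b c d, G.Adj a b → G.Adj c d → ¬G.Adj a c → ¬G.Adj a d → ¬G.Adj b c →
      ¬G.Adj b d → F a b = F c d := by
    intro a b c d hab hcd hac had hbc hbd
    have n1 : a ≠ c := by rintro rfl; exact hbc hab.symm
    have n2 : a ≠ d := by rintro rfl; exact hbd hab.symm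
    have n3 : b ≠ c := by rintro rfl; exact hac hab
    have n4 : b ≠ d := by rintro rfl; exact had hab
    simp only [hF]
    rw [red G a c d n1 n2 hcd, red G c a b n1.symm n3.symm hab,
      red (pivot G a b) b c d n3 n4
        (((pivot G a b).adj_comm _ _).1 ((pivot_adj_far G a b c d hac hbc).2 hcd.symm)),
      red (pivot G c d) d a b n2.symm n4.symm
        (((pivot G c d).adj_comm _ _).1 ((pivot_adj_far G c d a b
          (fun h => hac h.symm) (fun h => had h.symm)).2 hab.symm)),
      pivot_far G a b c d hac had hbc hbd, Set.pair_comm c a, Set.pair_comm d a,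
      Set.pair_comm c b, Set.pair_comm d b]
    ring
  have allF : ∀ a b c d, G.Adj a b → G.Adj c d → F a b = F c d := by
    have link : ∀ a b c d, G.Adj a b → G.Adj c d → G.Adj a c → F a b = F c d := by
      intro a b c d hab hcd hac
      rw [stepF a b c hab hac, symF a c hac, stepF c a d hac.symm hcd]
    intro a b c d hab hcd
    by_cases hac : G.Adj a c
    · exact link a b c d hab hcd hac
    by_cases had : G.Adj a d
    · rw [symF c d hcd]
      exact link a b d c hab hcd.symm had
    by_cases hbc : G.Adj b c
    · rw [symF a b hab]
      exact link b a c d hab.symm hcd hbc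
    by_cases hbd : G.Adj b d
    · rw [symF a b hab, symF c d hcd]
      exact link b a d c hab.symm hcd.symm hbd
    exact farF a b c d hab hcd hac had hbc hbd
  have hex : ∃ e : V × V, G.Adj e.1 e.2 := ⟨(a₀, b₀), hab₀⟩
  rw [interlaceAux, dif_pos hex]
  exact allF _ _ _ _ hex.choose_spec hab₀

theorem isoInv_succ {n : ℕ} (h0 : IsoInv.{u} n) (hr : Reduces.{u} n) : IsoInv.{u} (n + 1) := by
  intro V W _ _ G H hV e
  have hW : Nat.card W = n + 1 := by rw [← hV]; exact (Nat.card_congr e.toEquiv).symm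
  by_cases hex : ∃ p : V × V, G.Adj p.1 p.2
  · obtain ⟨⟨a, b⟩, hab⟩ := hex
    have hab' : H.Adj (e a) (e b) := e.map_rel_iff.2 hab
    have hcard : ∀ a : V, Nat.card (({a} : Set V)ᶜ : Set V) = n := by
      intro a
      have := card_compl (n := n) (∅ : Set V) a (by simp) (by simpa using hV)
      simpa using this
    have hdel : ∀ (K : SimpleGraph V) (L : SimpleGraph W) (c : V),
        (∀ x y, L.Adj (e x) (e y) ↔ K.Adj x y) →
        interlaceAux n (del K c) = interlaceAux n (del L (e c)) := by
      intro K L c hKL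
      refine h0 _ _ (hcard c) ⟨e.toEquiv.subtypeEquiv ?_, ?_⟩
      · intro x
        simp
      · rintro ⟨x, hx⟩ ⟨y, hy⟩
        exact hKL x y
    rw [hr G a b hV hab, hr H (e a) (e b) hW hab', hdel G H a (fun x y => e.map_rel_iff),
      hdel (pivot G a b) (pivot H (e a) (e b)) b]
    intro x y
    simp only [adj_pivot, Distinguished, e.map_adj_iff, ne_eq, EmbeddingLike.apply_eq_iff_eq]
  · have hex' : ¬∃ p : W × W, H.Adj p.1 p.2 := by
      rintro ⟨⟨a, b⟩, hab⟩
      exact hex ⟨(e.symm a, e.symm b), e.symm.map_adj_iff.2 hab⟩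
    rw [interlaceAux, interlaceAux, dif_neg hex, dif_neg hex']

theorem reduces_zero : Reduces.{u} 0 := by
  intro V _ G a b hV hab
  have := (Nat.card_eq_one_iff_unique.1 hV).1
  exact absurd (Subsingleton.elim a b) hab.ne

theorem isoInv_and_reduces (n : ℕ) : IsoInv.{u} n ∧ Reduces.{u} n := by
  induction n with
  | zero => exact ⟨fun _ _ _ _ => rfl, reduces_zero⟩
  | succ n ih => exact ⟨isoInv_succ ih.1 ih.2, reduces_succ ih.1 ih.2⟩

theorem interlacePoly_congr {V W : Type u} [Finite V] [Finite W] {G : SimpleGraph V}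
    {H : SimpleGraph W} (e : G ≃g H) : interlacePoly G = interlacePoly H := by
  unfold interlacePoly
  rw [(isoInv_and_reduces _).1 G H rfl e, Nat.card_congr e.toEquiv]

/-- `q(G) = q(G - a) + q(G ^ {ab} - b)` for every edge `ab` of `G`. -/
theorem interlacePoly_of_adj {V : Type u} [Finite V] (G : SimpleGraph V) {a b : V}
    (hab : G.Adj a b) :
    interlacePoly G = interlacePoly (del G a) + interlacePoly (del (pivot G a b) b) := by
  obtain ⟨n, hn⟩ : ∃ n, Nat.card V = n + 1 :=
    ⟨Nat.card V - 1, by have : Nonempty V := ⟨a⟩; have := Nat.card_pos (α := V); omega⟩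
  have hcard : ∀ a : V, Nat.card (({a} : Set V)ᶜ : Set V) = n := by
    intro a
    have := card_compl (n := n) (∅ : Set V) a (by simp) (by simpa using hn)
    simpa using this
  unfold interlacePoly
  rw [hcard, hcard, hn]
  exact (isoInv_and_reduces n).2 G a b hn hab

/-- `q(E_n) = X ^ n` for the edgeless graph with `n` vertices. -/
theorem interlacePoly_bot (V : Type u) :
    interlacePoly (⊥ : SimpleGraph V) = X ^ Nat.card V := by
  unfold interlacePoly
  generalize Nat.card V = n
  cases n with
  | zero => rw [interlaceAux, pow_zero]
  | succ n => rw [interlaceAux, dif_neg (by simp)]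

end Interlace

/-! ### Directed multigraphs, circuits and circuit partitions -/

/-- A directed multigraph with vertex set `V` and edge set `E`. Loops, multiple edges and multiple
loops are allowed, and all edges are distinguishable. -/
structure MultiDigraph (V : Type*) (E : Type*) where
  /-- the tail of an edge -/
  src : E → V
  /-- the head of an edge -/
  tgt : E → V

namespace MultiDigraph

variable {V E : Type*}

/-- Every vertex has in-degree two and out-degree two (a loop counts once for each). -/
def IsTwoInTwoOut (D : MultiDigraph V E) : Prop :=
  ∀ v : V, {e : E | D.tgt e = v}.ncard = 2 ∧ {e : E | D.src e = v}.ncard = 2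

/-- A circuit: a non-empty cyclic sequence of distinct edges, each of which ends where the
(cyclically) next one starts. Vertices may be repeated. -/
structure IsCircuit (D : MultiDigraph V E) (c : Cycle E) : Prop where
  ne_nil : c ≠ Cycle.nil
  nodup : c.Nodup
  chain : c.Chain (fun e f => D.tgt e = D.src f)

/-- An Euler circuit: a circuit that uses every edge (hence, if no vertex is isolated, visits
every vertex). -/
structure IsEulerCircuit (D : MultiDigraph V E) (c : Cycle E) : Prop where
  isCircuit : D.IsCircuit c
  mem : ∀ e : E, e ∈ c

/-- A partition of the edges of `D` into circuits. -/
structure IsCircuitPartition (D : MultiDigraph V E) (P : Finset (Cycle E)) : Prop where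
  isCircuit : ∀ c ∈ P, D.IsCircuit c
  existsUnique_mem : ∀ e : E, ∃! c : Cycle E, c ∈ P ∧ e ∈ c

/-- `r_k(D)`, the number of partitions of the edges of `D` into `k` circuits. -/
noncomputable def circuitPartitionCount (D : MultiDigraph V E) (k : ℕ) : ℕ :=
  {P : Finset (Cycle E) | D.IsCircuitPartition P ∧ P.card = k}.ncard

/-- The circuit partition polynomial `r(D) = ∑ₖ r_k(D) X ^ k` of a digraph with finitely many
edges (there are at most as many circuits in a partition as there are edges). -/
noncomputable def circuitPartitionPoly (D : MultiDigraph V E) : ℤ[X] :=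
  ∑ k ∈ Finset.range (Nat.card E + 1), (D.circuitPartitionCount k : ℤ[X]) * X ^ k

/-- The Martin polynomial `m(D; x) = r(D; x - 1) / (x - 1)`, as an element of `ℤ(x)`. -/
noncomputable def martin (D : MultiDigraph V E) : RatFunc ℤ :=
  algebraMap ℤ[X] (RatFunc ℤ) (D.circuitPartitionPoly.comp (X - 1)) /
    algebraMap ℤ[X] (RatFunc ℤ) (X - 1)

/-- The circuit `c` visits `a` and `b` in the cyclic order `… a … b … a … b …`. A traversal of
`c` visits the tails of its edges, in this order. -/
def Interlaced (D : MultiDigraph V E) (c : Cycle E) (a b : V) : Prop :=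
  a ≠ b ∧ ∃ l : List E, (l : Cycle E) = c ∧ [a, b, a, b].Sublist (l.map D.src)

theorem Interlaced.symm {D : MultiDigraph V E} {c : Cycle E} {a b : V}
    (h : D.Interlaced c a b) : D.Interlaced c b a := by
  obtain ⟨hab, l, rfl, hl⟩ := h
  refine ⟨hab.symm, ?_⟩
  obtain ⟨r₁, r₂, h₁, ha, h₂⟩ := List.cons_sublist_iff.1 hl
  obtain ⟨l₁, l₂, rfl, rfl, rfl⟩ := List.map_eq_append_iff.1 h₁
  refine ⟨l₂ ++ l₁, Cycle.coe_eq_coe.2 List.isRotated_append, ?_⟩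
  rw [List.map_append]
  exact h₂.append (List.singleton_sublist.2 ha)

/-- The interlace graph `H(c)` of a circuit `c`: it has the vertices of `D`, and `a`, `b` are
adjacent when they are interlaced in `c`. -/
def interlaceGraph (D : MultiDigraph V E) (c : Cycle E) : SimpleGraph V where
  Adj := D.Interlaced c
  symm := ⟨fun _ _ h => h.symm⟩
  loopless := ⟨fun _ h => h.1 rfl⟩

end MultiDigraph

/-! Both polynomials are sums over the sets `S` of vertices, governed by the nullity over `ZMod 2`
of the adjacency matrix of the induced subgraph on `S`: `q(H)` is the sum of `(X - 1) ^ nullity H S`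
and `r(D)` is the sum of `X ^ (1 + nullity H S)`. The theorem follows by substitution, term by term.

The first expansion (`interlacePoly_eq_sum`) holds for every finite simple graph. For an edge `ab`,
the sets avoiding `a` account for `G - a`. Sets containing `a` correspond to sets avoiding `b`, with
the pivoted graph in place of `G`; nullity is preserved because pivoting is elimination of the two
coordinates `a` and `b` (`nullity_pivot_of_mem`, `nullity_pivot_insert`).

For the second, a circuit partition is a permutation of the edges compatible with heads and tails.
Such a permutation comes from the successor map of `C` by swapping the two outgoing edges at the
vertices of a unique set `S` (`sum_isTransition`). Its number of cycles is the dimension of the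
space of functions on edges that it leaves invariant (`finrank_invariants`). Followed along `C`, an
invariant function has a starting value and one jump `g v` for each vertex `v`, with `g` zero off
`S`. Since the value changes between the two visits to `v` exactly through the jumps at vertices
visited once in between, consistency at the vertices of `S` says that `g` lies in the kernel of the
interlace matrix on `S` (`potential_add_swap`, `card_orbitCycles_swapPerm_mul`). The starting value
gives the extra `1`. -/

namespace Interlace

-- Nullity over `ZMod 2` and pivoting

universe u

open Classical in
/-- The kernel of the adjacency matrix over `ZMod 2` of the subgraph induced on `S`, as a space of
functions that vanish outside of `S`. -/
noncomputable def adjKernel {V : Type u} [Fintype V] (G : SimpleGraph V) (S : Finset V) :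
    Submodule (ZMod 2) (V → ZMod 2) where
  carrier := {g | (∀ v, v ∉ S → g v = 0) ∧ ∀ v ∈ S, ∑ w, G.adjMatrix (ZMod 2) v w * g w = 0}
  add_mem' := by
    rintro f g ⟨hf, hf'⟩ ⟨hg, hg'⟩
    refine ⟨fun v hv => by simp [hf v hv, hg v hv], fun v hv => ?_⟩
    simp only [Pi.add_apply, mul_add, Finset.sum_add_distrib, hf' v hv, hg' v hv, add_zero]
  zero_mem' := by simp
  smul_mem' := by
    rintro c g ⟨hg, hg'⟩
    refine ⟨fun v hv => by simp [hg v hv], fun v hv => ?_⟩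
    simp only [Pi.smul_apply, smul_eq_mul, mul_left_comm _ c, ← Finset.mul_sum, hg' v hv, mul_zero]

/-- The nullity over `ZMod 2` of the subgraph of `G` induced on `S`. -/
noncomputable def nullity {V : Type u} [Fintype V] (G : SimpleGraph V) (S : Finset V) : ℕ :=
  Module.finrank (ZMod 2) (adjKernel G S)

theorem mem_adjKernel {V : Type u} [Fintype V] {G : SimpleGraph V} [DecidableRel G.Adj]
    {S : Finset V} {g : V → ZMod 2} :
    g ∈ adjKernel G S ↔
      (∀ v, v ∉ S → g v = 0) ∧ ∀ v ∈ S, ∑ w, G.adjMatrix (ZMod 2) v w * g w = 0 := by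
  obtain rfl : ‹DecidableRel G.Adj› = fun _ _ => Classical.propDecidable _ :=
    Subsingleton.elim _ _
  rfl

/-- A finite space over `ZMod 2` has `2 ^ dim` elements, so counting determines the dimension. The
correspondences between kernels below thus need not be shown linear. -/
theorem finrank_eq_of_equiv {M N : Type*} [AddCommGroup M] [Module (ZMod 2) M] [AddCommGroup N]
    [Module (ZMod 2) N] [Finite M] [Finite N] (e : M ≃ N) :
    Module.finrank (ZMod 2) M = Module.finrank (ZMod 2) N := by
  have h := Nat.card_congr e
  rw [Module.natCard_eq_pow_finrank (K := ZMod 2) (V := M),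
    Module.natCard_eq_pow_finrank (K := ZMod 2) (V := N), Nat.card_zmod] at h
  exact Nat.pow_right_injective le_rfl h

-- The pair `xy` is toggled exactly when the 2 by 2 minor with rows `a, b` and columns `x, y` is
-- nonzero. For adjacent `a, b` this makes the pivot, away from `a` and `b`, the Schur complement of
-- the block on `{a, b}`.
open Classical in
theorem pivot_adjMatrix {V : Type u} [Fintype V] (G : SimpleGraph V) {a b x y : V} (hxa : x ≠ a)
    (hxb : x ≠ b) (hya : y ≠ a) (hyb : y ≠ b) :
    (pivot G a b).adjMatrix (ZMod 2) x y = G.adjMatrix (ZMod 2) x y +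
      G.adjMatrix (ZMod 2) x a * G.adjMatrix (ZMod 2) b y +
      G.adjMatrix (ZMod 2) x b * G.adjMatrix (ZMod 2) a y := by
  simp only [SimpleGraph.adjMatrix_apply, pivot_adj_of_ne G a b x y hxa hxb hya hyb,
    G.adj_comm x a, G.adj_comm x b]
  by_cases h1 : G.Adj x y <;> by_cases h2 : G.Adj a x <;> by_cases h3 : G.Adj b y <;>
    by_cases h4 : G.Adj b x <;> by_cases h5 : G.Adj a y <;> simp [h1, h2, h3, h4, h5] <;> decide

theorem pivot_self_inverse {V : Type u} (G : SimpleGraph V) (a b : V) :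
    pivot (pivot G a b) a b = G := by
  have h : ∀ x y, Distinguished (pivot G a b) a b x y ↔ Distinguished G a b x y := by
    intro x y
    simp only [Distinguished, (pivot G a b).adj_comm _ a, (pivot G a b).adj_comm _ b,
      pivot_adj_left, pivot_adj_right, G.adj_comm _ a, G.adj_comm _ b]
  ext x y
  rw [adj_pivot, h, adj_pivot]
  tauto

theorem sum_split_pair {V : Type u} [Fintype V] [DecidableEq V] {a b : V} (hab : a ≠ b)
    (f : V → ZMod 2) :
    ∑ w, f w = f a + f b + ∑ w ∈ (Finset.univ.erase a).erase b, f w := by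
  rw [← Finset.add_sum_erase _ f (Finset.mem_univ a),
    ← Finset.add_sum_erase (Finset.univ.erase a) f (a := b) (by simp [hab.symm]), add_assoc]

theorem two_eq_zero_zmod : (2 : ZMod 2) = 0 := by decide

theorem pivot_adjMatrix_left {V : Type u} (G : SimpleGraph V) [DecidableRel G.Adj] (a b : V)
    [DecidableRel (pivot G a b).Adj] (w : V) :
    (pivot G a b).adjMatrix (ZMod 2) a w = G.adjMatrix (ZMod 2) a w := by
  simp only [SimpleGraph.adjMatrix_apply, pivot_adj_left]

theorem pivot_adjMatrix_right {V : Type u} (G : SimpleGraph V) [DecidableRel G.Adj] (a b : V)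
    [DecidableRel (pivot G a b).Adj] (w : V) :
    (pivot G a b).adjMatrix (ZMod 2) b w = G.adjMatrix (ZMod 2) b w := by
  simp only [SimpleGraph.adjMatrix_apply, pivot_adj_right]

theorem adjMatrix_comm {V : Type u} (G : SimpleGraph V) [DecidableRel G.Adj] (v w : V) :
    G.adjMatrix (ZMod 2) v w = G.adjMatrix (ZMod 2) w v := by
  simp only [SimpleGraph.adjMatrix_apply, G.adj_comm]

section Pivot

variable {V : Type u} [Fintype V]

open Classical in
theorem sum_pivot (G : SimpleGraph V) {a b v : V} (hva : v ≠ a) (hvb : v ≠ b)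
    (g : V → ZMod 2) :
    ∑ w ∈ (Finset.univ.erase a).erase b, (pivot G a b).adjMatrix (ZMod 2) v w * g w =
      ∑ w ∈ (Finset.univ.erase a).erase b, G.adjMatrix (ZMod 2) v w * g w +
      G.adjMatrix (ZMod 2) v a *
        ∑ w ∈ (Finset.univ.erase a).erase b, G.adjMatrix (ZMod 2) b w * g w +
      G.adjMatrix (ZMod 2) v b *
        ∑ w ∈ (Finset.univ.erase a).erase b, G.adjMatrix (ZMod 2) a w * g w := by
  rw [Finset.mul_sum, Finset.mul_sum, ← Finset.sum_add_distrib, ← Finset.sum_add_distrib]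
  refine Finset.sum_congr rfl fun w hw => ?_
  simp only [Finset.mem_erase, Finset.mem_univ, and_true] at hw
  rw [pivot_adjMatrix G hva hvb hw.2 hw.1]
  ring

open Classical in
theorem sum_update_off {a b : V} (M : V → ZMod 2) (g g' : V → ZMod 2)
    (h : ∀ w, w ≠ a → w ≠ b → g' w = g w) :
    ∑ w ∈ (Finset.univ.erase a).erase b, M w * g' w =
      ∑ w ∈ (Finset.univ.erase a).erase b, M w * g w := by
  refine Finset.sum_congr rfl fun w hw => ?_
  simp only [Finset.mem_erase, Finset.mem_univ, and_true] at hw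
  rw [h w hw.2 hw.1]

-- Since `g b = 0`, row `a` says that the off-pair sum of row `a` vanishes. Pivoting then changes
-- row `v` only by `v`'s entry at `a` times the off-pair sum of row `b`; adding that sum to `g a`
-- cancels the change. The new coordinate is the full row `b` sum because row `b` has entry `1` at
-- `a`.
open Classical in
theorem update_mem_adjKernel_pivot (G : SimpleGraph V) {a b : V} (hab : G.Adj a b) {T : Finset V}
    (ha : a ∈ T) (hb : b ∉ T) {g : V → ZMod 2} (hg : g ∈ adjKernel G T) :
    Function.update g a (∑ w, G.adjMatrix (ZMod 2) b w * g w) ∈ adjKernel (pivot G a b) T := by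
  have hne := hab.ne
  rw [mem_adjKernel] at hg ⊢
  obtain ⟨hg0, hg1⟩ := hg
  have hgb := hg0 b hb
  refine ⟨fun v hv => ?_, fun v hv => ?_⟩
  · rw [Function.update_of_ne (by rintro rfl; exact hv ha)]
    exact hg0 v hv
  have hoff : ∀ w, w ≠ a → w ≠ b →
      Function.update g a (∑ w, G.adjMatrix (ZMod 2) b w * g w) w = g w :=
    fun w hw _ => Function.update_of_ne hw _ _
  have hva := hg1 a ha
  rw [sum_split_pair hne, hgb] at hva
  rw [sum_split_pair hne, sum_update_off _ _ _ hoff, Function.update_self,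
    Function.update_of_ne hne.symm, hgb]
  by_cases h : v = a
  · subst h
    simp only [pivot_adjMatrix_left]
    simpa using hva
  have hvb : v ≠ b := by rintro rfl; exact hb hv
  have hv' := hg1 v hv
  rw [sum_split_pair hne, hgb] at hv'
  rw [sum_pivot G h hvb, sum_split_pair hne, hgb, adjMatrix_comm (pivot G a b) v a,
    pivot_adjMatrix_left, adjMatrix_comm G a v]
  simp only [SimpleGraph.adjMatrix_apply, hab.symm, SimpleGraph.irrefl, if_true, if_false]
    at hva hv' ⊢
  linear_combination hv' + (if G.Adj v b then 1 else 0) * hva + (if G.Adj v a then 1 else 0) *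
    (∑ w ∈ (Finset.univ.erase a).erase b, (if G.Adj b w then 1 else 0) * g w) * two_eq_zero_zmod

open Classical in
theorem update_update_adjKernel (G : SimpleGraph V) {a b : V} (hab : G.Adj a b) {T : Finset V}
    (hb : b ∉ T) {g : V → ZMod 2} (hg : g ∈ adjKernel G T) :
    Function.update (Function.update g a (∑ w, G.adjMatrix (ZMod 2) b w * g w)) a
      (∑ w, (pivot G a b).adjMatrix (ZMod 2) b w *
        Function.update g a (∑ w, G.adjMatrix (ZMod 2) b w * g w) w) = g := by
  have hne := hab.ne
  have hgb := (mem_adjKernel.1 hg).1 b hb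
  have hoff : ∀ w, w ≠ a → w ≠ b →
      Function.update g a (∑ w, G.adjMatrix (ZMod 2) b w * g w) w = g w :=
    fun w hw _ => Function.update_of_ne hw _ _
  rw [Function.update_idem, Function.update_eq_self_iff]
  simp only [pivot_adjMatrix_right]
  rw [sum_split_pair hne, sum_update_off _ _ _ hoff, Function.update_self,
    Function.update_of_ne hne.symm, hgb, sum_split_pair hne, hgb]
  simp only [SimpleGraph.adjMatrix_apply, hab.symm, if_true]
  linear_combination
    (∑ w ∈ (Finset.univ.erase a).erase b, (if G.Adj b w then 1 else 0) * g w) * two_eq_zero_zmod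

/-- Pivoting is an involution that keeps row `b`, so the same update of the coordinate at `a` serves
as its own inverse. -/
theorem nullity_pivot_of_mem (G : SimpleGraph V) {a b : V} (hab : G.Adj a b) {T : Finset V}
    (ha : a ∈ T) (hb : b ∉ T) : nullity G T = nullity (pivot G a b) T := by
  classical
  have hab' : (pivot G a b).Adj a b := (pivot_adj_left ..).2 hab
  refine finrank_eq_of_equiv ⟨fun g => ⟨_, update_mem_adjKernel_pivot G hab ha hb g.2⟩,
    fun g => ⟨Function.update g a (∑ w, (pivot G a b).adjMatrix (ZMod 2) b w * g.1 w), ?_⟩,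
    fun g => Subtype.ext ?_, fun g => Subtype.ext ?_⟩
  · have := update_mem_adjKernel_pivot _ hab' ha hb g.2
    rwa [pivot_self_inverse] at this
  · exact update_update_adjKernel G hab hb g.2
  · have := update_update_adjKernel _ hab' hb g.2
    simpa only [pivot_self_inverse] using this

-- Gaussian elimination: the equations at `a` and `b` determine `g b` and `g a` from the other
-- coordinates, and substituting them into the remaining equations leaves the pivoted matrix on `T`.
open Classical in
theorem nullity_pivot_insert (G : SimpleGraph V) {a b : V} (hab : G.Adj a b) {T : Finset V}
    (ha : a ∉ T) (hb : b ∉ T) :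
    nullity G (insert a (insert b T)) = nullity (pivot G a b) T := by
  have hne := hab.ne
  have hoff : ∀ (g : V → ZMod 2) (x y : ZMod 2) (w : V), w ≠ a → w ≠ b →
      Function.update (Function.update g a x) b y w = g w := by
    intro g x y w h1 h2
    rw [Function.update_of_ne h2, Function.update_of_ne h1]
  have hua : ∀ (g : V → ZMod 2) (x y : ZMod 2),
      Function.update (Function.update g a x) b y a = x := by
    intro g x y
    rw [Function.update_of_ne hne, Function.update_self]
  have hub : ∀ (g : V → ZMod 2) (x y : ZMod 2),
      Function.update (Function.update g a x) b y b = y := by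
    intro g x y
    rw [Function.update_self]
  have main : ∀ g ∈ adjKernel G (insert a (insert b T)),
      g b + ∑ w ∈ (Finset.univ.erase a).erase b, G.adjMatrix (ZMod 2) a w * g w = 0 ∧
      g a + ∑ w ∈ (Finset.univ.erase a).erase b, G.adjMatrix (ZMod 2) b w * g w = 0 := by
    intro g hg
    rw [mem_adjKernel] at hg
    have h1 := hg.2 a (by simp)
    have h2 := hg.2 b (by simp)
    rw [sum_split_pair hne] at h1 h2
    simp only [SimpleGraph.adjMatrix_apply, hab, hab.symm, SimpleGraph.irrefl, if_true, if_false,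
      zero_mul, one_mul, zero_add, add_zero] at h1 h2 ⊢
    exact ⟨h1, h2⟩
  refine finrank_eq_of_equiv ⟨
    fun g => ⟨Function.update (Function.update g.1 a 0) b 0, ?_⟩,
    fun g => ⟨Function.update (Function.update g.1 a
      (∑ w ∈ (Finset.univ.erase a).erase b, G.adjMatrix (ZMod 2) b w * g.1 w)) b
      (∑ w ∈ (Finset.univ.erase a).erase b, G.adjMatrix (ZMod 2) a w * g.1 w), ?_⟩,
    fun g => Subtype.ext ?_, fun g => Subtype.ext ?_⟩
  · obtain ⟨g, hg⟩ := g
    obtain ⟨h1, h2⟩ := main g hg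
    rw [mem_adjKernel] at hg ⊢
    refine ⟨fun v hv => ?_, fun v hv => ?_⟩
    · by_cases hva : v = a
      · rw [hva, hua]
      by_cases hvb : v = b
      · rw [hvb, hub]
      rw [hoff _ _ _ _ hva hvb]
      exact hg.1 v (by simp [hva, hvb, hv])
    have hva : v ≠ a := by rintro rfl; exact ha hv
    have hvb : v ≠ b := by rintro rfl; exact hb hv
    have h3 := hg.2 v (by simp [hv])
    rw [sum_split_pair hne] at h3
    rw [sum_split_pair hne, hua, hub, sum_update_off _ _ _ (hoff g 0 0), sum_pivot G hva hvb]
    linear_combination h3 + G.adjMatrix (ZMod 2) v a * h2 + G.adjMatrix (ZMod 2) v b * h1 -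
      (G.adjMatrix (ZMod 2) v a * g a + G.adjMatrix (ZMod 2) v b * g b) * two_eq_zero_zmod
  · obtain ⟨g, hg⟩ := g
    rw [mem_adjKernel] at hg ⊢
    have hga := hg.1 a ha
    have hgb := hg.1 b hb
    refine ⟨fun v hv => ?_, fun v hv => ?_⟩
    · simp only [Finset.mem_insert, not_or] at hv
      rw [hoff _ _ _ _ hv.1 hv.2.1]
      exact hg.1 v hv.2.2
    rw [sum_split_pair hne, hua, hub, sum_update_off _ _ _ (hoff g _ _)]
    by_cases hva : v = a
    · subst hva
      simp only [SimpleGraph.adjMatrix_apply, hab, SimpleGraph.irrefl, if_true, if_false]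
      linear_combination (∑ w ∈ (Finset.univ.erase v).erase b, (if G.Adj v w then 1 else 0) * g w) *
        two_eq_zero_zmod
    by_cases hvb : v = b
    · subst hvb
      simp only [SimpleGraph.adjMatrix_apply, hab.symm, SimpleGraph.irrefl, if_true, if_false]
      linear_combination (∑ w ∈ (Finset.univ.erase a).erase v, (if G.Adj v w then 1 else 0) * g w) *
        two_eq_zero_zmod
    have h3 := hg.2 v (by simpa [hva, hvb] using hv)
    rw [sum_split_pair hne, hga, hgb, sum_pivot G hva hvb] at h3
    linear_combination h3
  · obtain ⟨g, hg⟩ := g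
    obtain ⟨h1, h2⟩ := main g hg
    funext v
    dsimp only
    rw [sum_update_off _ _ _ (hoff g 0 0), sum_update_off _ _ _ (hoff g 0 0)]
    by_cases hvb : v = b
    · rw [hvb, hub]
      linear_combination h1 - g b * two_eq_zero_zmod
    by_cases hva : v = a
    · rw [hva, hua]
      linear_combination h2 - g a * two_eq_zero_zmod
    rw [hoff _ _ _ _ hva hvb, hoff _ _ _ _ hva hvb]
  · obtain ⟨g, hg⟩ := g
    rw [mem_adjKernel] at hg
    funext v
    dsimp only
    by_cases hvb : v = b
    · rw [hvb, hub, hg.1 b hb]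
    by_cases hva : v = a
    · rw [hva, hua, hg.1 a ha]
    rw [hoff _ _ _ _ hva hvb, hoff _ _ _ _ hva hvb]

end Pivot

theorem nullity_del {V : Type u} [Fintype V] (G : SimpleGraph V) (a : V)
    [Fintype ({a}ᶜ : Set V)] (S : Finset ({a}ᶜ : Set V)) :
    nullity (del G a) S = nullity G (S.map (Function.Embedding.subtype _)) := by
  classical
  have key : ∀ (g : V → ZMod 2), g a = 0 → ∀ v : ({a}ᶜ : Set V),
      ∑ w, (del G a).adjMatrix (ZMod 2) v w * g w = ∑ w, G.adjMatrix (ZMod 2) v w * g w := by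
    intro g hg v
    rw [← Finset.sum_subset (Finset.subset_univ (Finset.univ.erase a)) (by
      intro x _ hx
      simp only [Finset.mem_erase, Finset.mem_univ, and_true, not_not] at hx
      rw [hx, hg, mul_zero])]
    symm
    refine Finset.sum_subtype _ (by simp) (fun w => G.adjMatrix (ZMod 2) v w * g w)
  refine finrank_eq_of_equiv ⟨
    fun g => ⟨fun v => if h : v ∈ ({a}ᶜ : Set V) then g.1 ⟨v, h⟩ else 0, ?_⟩,
    fun g => ⟨fun v => g.1 v, ?_⟩, fun g => Subtype.ext ?_, fun g => Subtype.ext ?_⟩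
  · obtain ⟨g, hg⟩ := g
    rw [mem_adjKernel] at hg ⊢
    refine ⟨fun v hv => ?_, fun v hv => ?_⟩
    · split_ifs with h
      · exact hg.1 ⟨v, h⟩ fun h' => hv (Finset.mem_map.2 ⟨_, h', rfl⟩)
      · rfl
    obtain ⟨v, hv', rfl⟩ := Finset.mem_map.1 hv
    refine (key _ (by simp) v).symm.trans ?_
    rw [← hg.2 v hv']
    refine Finset.sum_congr rfl fun w _ => ?_
    rw [dif_pos w.2]
  · obtain ⟨g, hg⟩ := g
    rw [mem_adjKernel] at hg ⊢
    refine ⟨fun v hv => hg.1 v ?_, fun v hv => ?_⟩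
    · rintro h
      obtain ⟨w, hw, h⟩ := Finset.mem_map.1 h
      exact hv (Subtype.ext h ▸ hw)
    have hga : g a = 0 := hg.1 a (by simp)
    rw [key g hga]
    exact hg.2 v (Finset.mem_map.2 ⟨v, hv, rfl⟩)
  · funext v
    exact dif_pos v.2
  · obtain ⟨g, hg⟩ := g
    rw [mem_adjKernel] at hg
    funext v
    dsimp only
    split_ifs with h
    · rfl
    · exact (hg.1 v (by
        rintro h'
        obtain ⟨w, hw, rfl⟩ := Finset.mem_map.1 h'
        exact h w.2)).symm

theorem nullity_bot {V : Type u} [Fintype V] (S : Finset V) :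
    nullity (⊥ : SimpleGraph V) S = S.card := by
  classical
  have e : adjKernel (⊥ : SimpleGraph V) S ≃ (S → ZMod 2) := by
    refine ⟨fun g v => g.1 v, fun g => ⟨fun v => if h : v ∈ S then g ⟨v, h⟩ else 0, ?_⟩,
      fun g => Subtype.ext ?_, fun g => ?_⟩
    · rw [mem_adjKernel]
      exact ⟨fun v hv => dif_neg hv, fun v hv => by simp⟩
    · funext v
      have := g.2
      rw [mem_adjKernel] at this
      dsimp only
      split_ifs with h
      · rfl
      · exact (this.1 v h).symm
    · funext v
      exact dif_pos v.2
  rw [nullity, finrank_eq_of_equiv e, Module.finrank_fintype_fun_eq_card, Fintype.card_coe]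

/-- The binomial expansion of `((X - 1) + 1) ^ n`, as every set has nullity equal to its size. -/
theorem interlacePoly_bot_eq_sum (V : Type u) [Fintype V] :
    interlacePoly (⊥ : SimpleGraph V) = ∑ S : Finset V, (X - 1) ^ nullity ⊥ S := by
  rw [interlacePoly_bot, Nat.card_eq_fintype_card]
  simp only [nullity_bot]
  have := Finset.sum_pow_mul_eq_add_pow (X - 1 : ℤ[X]) 1 (Finset.univ : Finset V)
  simp only [one_pow, mul_one, sub_add_cancel, Finset.powerset_univ, Finset.card_univ] at this
  exact this.symm

/-- The interlace polynomial is the generating function of the nullities of induced subgraphs. -/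
theorem interlacePoly_eq_sum {V : Type u} [Fintype V] (G : SimpleGraph V) :
    interlacePoly G = ∑ S : Finset V, (X - 1) ^ nullity G S := by
  classical
  induction h : Fintype.card V generalizing V with
  | zero =>
    have : IsEmpty V := Fintype.card_eq_zero_iff.1 h
    obtain rfl : G = ⊥ := Subsingleton.elim _ _
    exact interlacePoly_bot_eq_sum V
  | succ n ih =>
    by_cases hG : ∃ a b, G.Adj a b
    · obtain ⟨a, b, hab⟩ := hG
      have hcard : ∀ c : V, Fintype.card ({c}ᶜ : Set V) = n := by
        intro c
        rw [Fintype.card_compl_set, h]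
        simp
      have hdel : ∀ (K : SimpleGraph V) (c : V),
          interlacePoly (del K c) = ∑ S with c ∉ S, (X - 1) ^ nullity K S := by
        intro K c
        rw [ih (del K c) (hcard c)]
        refine Finset.sum_nbij' (fun S => S.map (Function.Embedding.subtype _))
          (fun S => S.subtype _) ?_ ?_ ?_ ?_ ?_
        · exact fun S _ => by simp
        · exact fun S _ => Finset.mem_univ _
        · exact fun S _ => by ext x; rw [Finset.mem_subtype]; exact Finset.mem_map' _
        · intro S hS
          rw [Finset.subtype_map]
          refine Finset.filter_true_of_mem fun x hx => ?_
          rintro rfl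
          exact (Finset.mem_filter.1 hS).2 hx
        · intro S _
          rw [nullity_del]
      rw [interlacePoly_of_adj G hab, hdel, hdel,
        ← Finset.sum_filter_add_sum_filter_not Finset.univ (fun S : Finset V => a ∉ S)]
      congr 1
      have hne := hab.ne
      -- Sets avoiding `b` (terms of the pivot minus `b`) are matched with sets containing `a` (the
      -- remaining terms of `G`): a set through `a` is kept, any other gains both `a` and `b`.
      refine Finset.sum_nbij' (fun T => if a ∈ T then T else insert a (insert b T))
        (fun S => if b ∈ S then (S.erase a).erase b else S) ?_ ?_ ?_ ?_ ?_
      · intro T hT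
        simp only [Finset.mem_filter, Finset.mem_univ, true_and, not_not] at hT ⊢
        split_ifs with h1 <;> simp [h1]
      · intro S hS
        simp only [Finset.mem_filter, Finset.mem_univ, true_and, not_not] at hS ⊢
        split_ifs with h1 <;> simp [h1]
      · intro T hT
        simp only [Finset.mem_filter, Finset.mem_univ, true_and] at hT
        by_cases h1 : a ∈ T
        · simp only [h1, if_true, hT, if_false]
        · simp only [h1, if_false, Finset.mem_insert, true_or, or_true, if_true]
          ext x
          simp only [Finset.mem_erase, Finset.mem_insert]
          grind
      · intro S hS
        simp only [Finset.mem_filter, Finset.mem_univ, true_and, not_not] at hS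
        by_cases h1 : b ∈ S
        · simp only [h1, if_true, Finset.mem_erase, ne_eq, not_true_eq_false, false_and, and_false,
            if_false]
          ext x
          simp only [Finset.mem_erase, Finset.mem_insert]
          grind
        · simp only [h1, if_false, hS, if_true]
      · intro T hT
        simp only [Finset.mem_filter, Finset.mem_univ, true_and] at hT
        split_ifs with h1
        · rw [nullity_pivot_of_mem G hab h1 hT]
        · rw [nullity_pivot_insert G hab h1 hT]
    · obtain rfl : G = ⊥ := by
        ext a b
        simp only [SimpleGraph.bot_adj, iff_false]
        exact fun hab => hG ⟨a, b, hab⟩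
      exact interlacePoly_bot_eq_sum V

end Interlace

/-! ### Circuit partitions as permutations of the edges -/

namespace MultiDigraph

open Function

variable {V E : Type*}

theorem perm_mem_periodicPts [Finite E] (π : Equiv.Perm E) (e : E) : e ∈ periodicPts π :=
  π.injective.mem_periodicPts e

open Classical in
/-- The cycles of a permutation, fixed points included. -/
noncomputable def orbitCycles [Fintype E] (π : Equiv.Perm E) : Finset (Cycle E) :=
  Finset.univ.image (periodicOrbit π)

theorem mem_orbitCycles [Fintype E] {π : Equiv.Perm E} {c : Cycle E} :
    c ∈ orbitCycles π ↔ ∃ e, periodicOrbit π e = c := by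
  simp [orbitCycles]

theorem periodicOrbit_eq_of_mem [Finite E] {π : Equiv.Perm E} {e f : E}
    (h : f ∈ periodicOrbit π e) : periodicOrbit π f = periodicOrbit π e := by
  obtain ⟨n, rfl⟩ := (mem_periodicOrbit_iff (perm_mem_periodicPts π e)).1 h
  exact periodicOrbit_apply_iterate_eq (perm_mem_periodicPts π e) n

theorem self_mem_periodicOrbit_perm [Finite E] (π : Equiv.Perm E) (e : E) :
    e ∈ periodicOrbit π e :=
  self_mem_periodicOrbit (perm_mem_periodicPts π e)

/-- A permutation of the edges each of which ends where its image starts. -/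
def IsTransition (D : MultiDigraph V E) (π : Equiv.Perm E) : Prop :=
  ∀ e, D.tgt e = D.src (π e)

theorem IsTransition.isCircuitPartition [Fintype E] {D : MultiDigraph V E} {π : Equiv.Perm E}
    (h : D.IsTransition π) : D.IsCircuitPartition (orbitCycles π) := by
  refine ⟨fun c hc => ?_, fun e => ⟨periodicOrbit π e,
    ⟨mem_orbitCycles.2 ⟨e, rfl⟩, self_mem_periodicOrbit_perm π e⟩, ?_⟩⟩
  · obtain ⟨e, rfl⟩ := mem_orbitCycles.1 hc
    refine ⟨?_, nodup_periodicOrbit, ?_⟩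
    · rw [ne_eq, periodicOrbit_eq_nil_iff_not_periodic_pt, not_not]
      exact perm_mem_periodicPts π e
    · rw [periodicOrbit_chain' _ (perm_mem_periodicPts π e)]
      intro n
      rw [iterate_succ_apply']
      exact h _
  · rintro c ⟨hc, hec⟩
    obtain ⟨f, rfl⟩ := mem_orbitCycles.1 hc
    exact (periodicOrbit_eq_of_mem hec).symm

/-- The cycle through an edge records the successor of that edge. -/
theorem orbitCycles_injective [Fintype E] :
    Injective (orbitCycles : Equiv.Perm E → Finset (Cycle E)) := by
  intro π π' h
  ext e
  have h1 : periodicOrbit π e ∈ orbitCycles π' := h ▸ mem_orbitCycles.2 ⟨e, rfl⟩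
  obtain ⟨f, hf⟩ := mem_orbitCycles.1 h1
  have h2 : periodicOrbit π e = periodicOrbit π' e := by
    rw [← hf]
    exact (periodicOrbit_eq_of_mem (hf ▸ self_mem_periodicOrbit_perm π e)).symm
  have h3 : (periodicOrbit π' e).Chain fun x y => π' x = y := by
    rw [periodicOrbit_chain' _ (perm_mem_periodicPts π' e)]
    exact fun n => (iterate_succ_apply' π' n e).symm
  rw [← h2, periodicOrbit_chain' _ (perm_mem_periodicPts π e)] at h3
  exact (h3 0).symm

theorem exists_eq_coe_cons {c : Cycle E} {e : E} (h : e ∈ c) : ∃ l : List E, c = ↑(e :: l) := by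
  induction c using Quotient.inductionOn' with
  | h l =>
    obtain ⟨l₁, l₂, rfl⟩ := List.append_of_mem (Cycle.mem_coe_iff.1 h)
    exact ⟨l₂ ++ l₁, Cycle.coe_eq_coe.2 List.isRotated_append⟩

theorem IsCircuit.exists_mem {D : MultiDigraph V E} {c : Cycle E} (hc : D.IsCircuit c) :
    ∃ e, e ∈ c := by
  have := hc.ne_nil
  induction c using Quotient.inductionOn' with
  | h l => exact List.exists_mem_of_ne_nil l fun hl => this (by rw [hl]; rfl)

theorem periodicOrbit_eq_of_next [DecidableEq E] [Finite E] {π : Equiv.Perm E} {c : Cycle E}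
    (hc : c.Nodup) (h : ∀ (x : E) (hx : x ∈ c), π x = c.next hc x hx) {e : E} (he : e ∈ c) :
    periodicOrbit π e = c := by
  obtain ⟨l, rfl⟩ := exists_eq_coe_cons he
  set L := e :: l with hL
  have hnd : L.Nodup := Cycle.nodup_coe_iff.1 hc
  have hpos : 0 < L.length := by simp [hL]
  have iter : ∀ i, π^[i] e = L[i % L.length]'(Nat.mod_lt _ hpos) := by
    intro i
    induction i with
    | zero => simp [hL]
    | succ i ih =>
      rw [iterate_succ_apply', ih, h _ (Cycle.mem_coe_iff.2 (List.getElem_mem _))]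
      refine (List.next_getElem L hnd _ _).trans ?_
      simp
  -- A smaller period would make an entry of the duplicate-free list `L` at a positive index equal
  -- to its first entry.
  have hper : minimalPeriod π e = L.length := by
    have h1 : IsPeriodicPt π L.length e := by
      rw [IsPeriodicPt, IsFixedPt, iter]
      simp [hL]
    refine le_antisymm (h1.minimalPeriod_le hpos) (not_lt.1 fun hlt => ?_)
    have h2 := iter (minimalPeriod π e)
    rw [iterate_minimalPeriod] at h2
    have h3 : L[0]'hpos = L[minimalPeriod π e % L.length]'(Nat.mod_lt _ hpos) := h2
    rw [hnd.getElem_inj_iff, Nat.mod_eq_of_lt hlt] at h3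
    exact (minimalPeriod_pos_of_mem_periodicPts (perm_mem_periodicPts π e)).ne h3
  rw [periodicOrbit, hper]
  congr 1
  refine List.ext_getElem (by simp) fun i h1 h2 => ?_
  rw [List.getElem_map, List.getElem_range, iter]
  congr 1
  exact Nat.mod_eq_of_lt h2

/-- The permutation sends each edge to its successor in the unique circuit of `P` containing it. -/
theorem IsCircuitPartition.exists_perm [Fintype E] {D : MultiDigraph V E} {P : Finset (Cycle E)}
    (hP : D.IsCircuitPartition P) : ∃ π, D.IsTransition π ∧ orbitCycles π = P := by
  classical
  choose c hc huniq using hP.existsUnique_mem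
  have hnd : ∀ e, (c e).Nodup := fun e => (hP.isCircuit _ (hc e).1).nodup
  have same : ∀ e f, f ∈ c e → c e = c f := fun e f hf => huniq f (c e) ⟨(hc e).1, hf⟩
  have hnext : ∀ (c c' : Cycle E) (h : c.Nodup) (h' : c'.Nodup) (x : E) (hx : x ∈ c)
      (hx' : x ∈ c'), c = c' → c.next h x hx = c'.next h' x hx' := by
    rintro c c' h h' x hx hx' rfl
    rfl
  have inj : Injective fun e => (c e).next (hnd e) e (hc e).2 := by
    intro e f hef
    dsimp only at hef
    have h1 : c e = c f := by
      have h2 := same e _ ((c e).next_mem (hnd e) e (hc e).2)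
      have h3 := same f _ ((c f).next_mem (hnd f) f (hc f).2)
      rw [h2, h3, hef]
    have hf : f ∈ c e := h1 ▸ (hc f).2
    rw [hnext (c f) (c e) (hnd f) (hnd e) f (hc f).2 hf h1.symm] at hef
    rw [← (c e).prev_next (hnd e) e (hc e).2, ← (c e).prev_next (hnd e) f hf]
    congr 1
  let π : Equiv.Perm E := Equiv.ofBijective _ inj.bijective_of_finite
  have orb : ∀ e, periodicOrbit π e = c e := by
    intro e
    refine periodicOrbit_eq_of_next (hnd e) (fun x hx => ?_) (hc e).2
    exact hnext _ _ _ _ _ _ _ (same e x hx).symm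
  refine ⟨π, fun e => ?_, ?_⟩
  · have h := (hP.isCircuit _ (hc e).1).chain
    rw [← orb e, periodicOrbit_chain' _ (perm_mem_periodicPts π e)] at h
    exact h 0
  · ext d
    rw [mem_orbitCycles]
    refine ⟨?_, fun hd => ?_⟩
    · rintro ⟨e, rfl⟩
      rw [orb]
      exact (hc e).1
    · obtain ⟨e, he⟩ := (hP.isCircuit d hd).exists_mem
      exact ⟨e, (orb e).trans (huniq e d ⟨hd, he⟩).symm⟩

open Classical in
theorem circuitPartitionPoly_eq_sum [Fintype E] (D : MultiDigraph V E) :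
    D.circuitPartitionPoly =
      ∑ π : Equiv.Perm E with D.IsTransition π, X ^ (orbitCycles π).card := by
  have hcount : ∀ k, D.circuitPartitionCount k =
      {π : Equiv.Perm E | D.IsTransition π ∧ (orbitCycles π).card = k}.ncard := by
    intro k
    rw [circuitPartitionCount, ← Set.ncard_image_of_injective _ orbitCycles_injective]
    congr 1
    ext P
    constructor
    · rintro ⟨hP, rfl⟩
      obtain ⟨π, hπ, rfl⟩ := hP.exists_perm
      exact ⟨π, ⟨hπ, rfl⟩, rfl⟩
    · rintro ⟨π, ⟨hπ, hk⟩, rfl⟩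
      exact ⟨hπ.isCircuitPartition, hk⟩
  rw [circuitPartitionPoly, ← Finset.sum_fiberwise_of_maps_to (t := Finset.range (Nat.card E + 1))
    (g := fun π => (orbitCycles π).card)]
  · refine Finset.sum_congr rfl fun k _ => ?_
    rw [Finset.sum_congr rfl (g := fun _ => X ^ k)
      (fun π hπ => by rw [(Finset.mem_filter.1 hπ).2]), Finset.sum_const, nsmul_eq_mul, hcount]
    congr 2
    rw [Set.ncard_eq_toFinset_card', Finset.filter_filter]
    congr 1
    ext π
    simp
  · intro π _
    rw [Finset.mem_range, Nat.lt_succ_iff, Nat.card_eq_fintype_card]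
    exact Finset.card_image_le

/-- The functions over `ZMod 2` that are invariant under a permutation. -/
def invariants (π : Equiv.Perm E) : Submodule (ZMod 2) (E → ZMod 2) where
  carrier := {f | ∀ e, f (π e) = f e}
  add_mem' := fun hf hg e => by simp only [Pi.add_apply, hf e, hg e]
  zero_mem' := fun _ => rfl
  smul_mem' := fun c f hf e => by simp only [Pi.smul_apply, hf e]

theorem apply_iterate_of_mem_invariants {π : Equiv.Perm E} {f : E → ZMod 2}
    (hf : f ∈ invariants π) (n : ℕ) (e : E) : f (π^[n] e) = f e := by
  induction n with
  | zero => rfl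
  | succ n ih => rw [iterate_succ_apply', hf, ih]

/-- An invariant function is a free choice of one value on each cycle. This turns counting circuits
into linear algebra. -/
theorem finrank_invariants [Fintype E] (π : Equiv.Perm E) :
    Module.finrank (ZMod 2) (invariants π) = (orbitCycles π).card := by
  have key : ∀ (f : invariants π) (e e' : E), periodicOrbit π e' = periodicOrbit π e →
      f.1 e' = f.1 e := by
    intro f e e' h
    obtain ⟨n, rfl⟩ := (mem_periodicOrbit_iff (perm_mem_periodicPts π e)).1
      (h ▸ self_mem_periodicOrbit_perm π e')
    exact apply_iterate_of_mem_invariants f.2 n e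
  have e : (orbitCycles π → ZMod 2) ≃ invariants π := by
    refine Equiv.ofBijective (fun φ => ⟨fun e => φ ⟨_, mem_orbitCycles.2 ⟨e, rfl⟩⟩, fun e => ?_⟩)
      ⟨fun φ ψ h => ?_, fun f => ?_⟩
    · simp only [periodicOrbit_apply_eq (perm_mem_periodicPts π e)]
    · funext ⟨c, hc⟩
      obtain ⟨e, rfl⟩ := mem_orbitCycles.1 hc
      exact congrFun (Subtype.ext_iff.1 h) e
    · refine ⟨fun c => f.1 (mem_orbitCycles.1 c.2).choose, Subtype.ext (funext fun e => ?_)⟩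
      exact key f _ _ (mem_orbitCycles.1 (mem_orbitCycles.2 ⟨e, rfl⟩)).choose_spec
  rw [← Interlace.finrank_eq_of_equiv e, Module.finrank_fintype_fun_eq_card, Fintype.card_coe]

end MultiDigraph

/-! ### Visits along an Euler circuit and changes of transition -/

namespace MultiDigraph

open Function

variable {V E : Type*}

/-- The other edge with the same tail. -/
theorem IsTwoInTwoOut.exists_swap {D : MultiDigraph V E} (hD : D.IsTwoInTwoOut) :
    ∃ s : E → E, (∀ e, s e ≠ e) ∧ ∀ e f, D.src f = D.src e ↔ f = e ∨ f = s e := by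
  have h : ∀ e, ∃ e', e' ≠ e ∧ ∀ f, D.src f = D.src e ↔ f = e ∨ f = e' := by
    intro e
    obtain ⟨x, y, hxy, h⟩ := Set.ncard_eq_two.1 (hD (D.src e)).2
    have hf : ∀ f, D.src f = D.src e ↔ f = x ∨ f = y := fun f => Set.ext_iff.1 h f
    rcases (hf e).1 rfl with rfl | rfl
    · exact ⟨y, hxy.symm, hf⟩
    · exact ⟨x, hxy, fun f => (hf f).trans or_comm⟩
  choose s hs hs' using h
  exact ⟨s, hs, hs'⟩

theorem IsTwoInTwoOut.exists_src_eq {D : MultiDigraph V E} (hD : D.IsTwoInTwoOut) (v : V) :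
    ∃ e, D.src e = v := by
  have : {e | D.src e = v}.Nonempty := by
    rw [Set.nonempty_iff_ne_empty]
    intro h
    have h2 := (hD v).2
    simp [h] at h2
  exact this

theorem src_swap {D : MultiDigraph V E} {s : E → E}
    (hs' : ∀ e f, D.src f = D.src e ↔ f = e ∨ f = s e) (e : E) : D.src (s e) = D.src e :=
  (hs' e (s e)).2 (Or.inr rfl)

theorem swap_swap {D : MultiDigraph V E} {s : E → E} (hs : ∀ e, s e ≠ e)
    (hs' : ∀ e f, D.src f = D.src e ↔ f = e ∨ f = s e) (e : E) : s (s e) = e := by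
  rcases (hs' (s e) e).1 (src_swap hs' e).symm with h | h
  · exact absurd h.symm (hs e)
  · exact h.symm

theorem isChain_of_chain_coe {r : E → E → Prop} {l : List E} (h : (l : Cycle E).Chain r) :
    l.IsChain r := by
  cases l with
  | nil => exact List.IsChain.nil
  | cons a l =>
    rw [Cycle.chain_coe_cons, ← List.cons_append] at h
    exact h.left_of_append

section Words

variable [DecidableEq V]

/-- Each step adds the jump of the edge it reaches, so the jump at `z` counts and the one at `y`
does not. -/
theorem apply_eq_add_count (src : E → V) (w : V) (F : E → ZMod 2) (l : List E) (y z : E)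
    (h : (y :: (l ++ [z])).IsChain fun e f => F f = F e + if src f = w then 1 else 0) :
    F z = F y + (l.map src).count w + if src z = w then 1 else 0 := by
  induction l generalizing y with
  | nil =>
    simpa using h
  | cons x l ih =>
    rw [List.cons_append, List.isChain_cons_cons] at h
    rw [ih x h.2, h.1, List.map_cons, List.count_cons]
    by_cases hx : src x = w
    · simp only [hx, beq_self_eq_true, if_true, Nat.cast_add, Nat.cast_one]
      ring
    · simp [hx]

theorem count_map_src [Fintype E] {D : MultiDigraph V E} (hD : D.IsTwoInTwoOut) {l : List E}
    (hl : l.Nodup) (hmem : ∀ e, e ∈ l) (w : V) : (l.map D.src).count w = 2 := by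
  classical
  rw [← (hD w).2, Set.ncard_eq_toFinset_card', List.count, List.countP_map,
    List.countP_eq_length_filter, ← List.toFinset_card_of_nodup (hl.filter _)]
  congr 1
  ext e
  simp [hmem]

/-- A potential of the visits to `w` along `C` differs at the two visits to `v ≠ w` if and only
if `v` and `w` are interlaced. -/
theorem potential_add_swap [Fintype E] {D : MultiDigraph V E} (hD : D.IsTwoInTwoOut)
    {C : Cycle E} (hC : D.IsEulerCircuit C) [DecidableRel (D.interlaceGraph C).Adj]
    {s : E → E} (hs : ∀ e, s e ≠ e) (hs' : ∀ e f, D.src f = D.src e ↔ f = e ∨ f = s e)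
    {w : V} {F : E → ZMod 2}
    (hF : C.Chain fun e f => F f = F e + if D.src f = w then 1 else 0) (y : E) :
    F y + F (s y) = (if (D.interlaceGraph C).Adj (D.src y) w then 1 else 0) +
      if D.src y = w then 1 else 0 := by
  have hsrc : D.src (s y) = D.src y := src_swap hs' y
  obtain ⟨l, rfl⟩ := exists_eq_coe_cons (hC.mem y)
  have hsl : s y ∈ l := by
    have := Cycle.mem_coe_iff.1 (hC.mem (s y))
    simpa [hs y] using this
  obtain ⟨l₁, l₂, rfl⟩ := List.append_of_mem hsl
  have hnd : (y :: (l₁ ++ s y :: l₂)).Nodup := Cycle.nodup_coe_iff.1 hC.isCircuit.nodup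
  have hmem : ∀ e, e ∈ y :: (l₁ ++ s y :: l₂) := fun e => Cycle.mem_coe_iff.1 (hC.mem e)
  have hcount := count_map_src hD hnd hmem w
  have hstep : F (s y) = F y + (l₁.map D.src).count w + if D.src (s y) = w then 1 else 0 := by
    refine apply_eq_add_count D.src w F l₁ y (s y) ?_
    have h := isChain_of_chain_coe hF
    rw [show y :: (l₁ ++ s y :: l₂) = (y :: (l₁ ++ [s y])) ++ l₂ by simp] at h
    exact h.left_of_append
  simp only [List.map_cons, List.map_append, List.count_cons, List.count_append, hsrc] at hcount
  rw [hsrc] at hstep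
  -- If `w` is the tail of `y`, both visits to `w` are the endpoints `y` and `s y`; only the jump at
  -- `s y` remains.
  by_cases hw : D.src y = w
  · have h0 : (l₁.map D.src).count w = 0 := by
      simp only [hw, beq_self_eq_true, if_true] at hcount
      omega
    subst hw
    rw [hstep, h0]
    simp only [SimpleGraph.irrefl, if_true, if_false, Nat.cast_zero]
    linear_combination F y * Interlace.two_eq_zero_zmod
  -- Otherwise `w` is visited 0, 1 or 2 times between `y` and `s y`, and `F` changes exactly when
  -- the number is 1, which is interlacement.
  have hiff : (D.interlaceGraph ↑(y :: (l₁ ++ s y :: l₂))).Adj (D.src y) w ↔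
      F (s y) ≠ F y := by
    constructor
    · rintro ⟨-, l, hl, hsub⟩
      obtain ⟨r₁, r₂, h₁, ha, hsub⟩ := List.cons_sublist_iff.1 hsub
      obtain ⟨r₃, r₄, rfl, hb, hsub⟩ := List.cons_sublist_iff.1 hsub
      obtain ⟨r₅, r₆, rfl, hc, hd⟩ := List.cons_sublist_iff.1 hsub
      rw [List.singleton_sublist] at hd
      obtain ⟨m₁, t₁, rfl, rfl, h₂⟩ := List.map_eq_append_iff.1 h₁
      obtain ⟨m₂, t₂, rfl, rfl, h₃⟩ := List.map_eq_append_iff.1 h₂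
      obtain ⟨m₃, m₄, rfl, rfl, rfl⟩ := List.map_eq_append_iff.1 h₃
      rw [List.mem_map] at ha hc
      obtain ⟨e₁, he₁, hv₁⟩ := ha
      obtain ⟨e₃, he₃, hv₃⟩ := hc
      have hnd' : (m₁ ++ (m₂ ++ (m₃ ++ m₄))).Nodup := by
        rw [← Cycle.nodup_coe_iff, hl]
        exact hC.isCircuit.nodup
      have hmem' : ∀ e, e ∈ m₁ ++ (m₂ ++ (m₃ ++ m₄)) := by
        intro e
        rw [← Cycle.mem_coe_iff, hl]
        exact hC.mem e
      have hcount' := count_map_src hD hnd' hmem' w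
      rw [← hl] at hF
      have hch := isChain_of_chain_coe hF
      have hne : e₁ ≠ e₃ := by
        rintro rfl
        exact (List.disjoint_of_nodup_append hnd') he₁ (by simp [he₃])
      obtain ⟨p₁, q₁, rfl⟩ := List.append_of_mem he₁
      obtain ⟨p₃, q₃, rfl⟩ := List.append_of_mem he₃
      have hlist : p₁ ++ e₁ :: q₁ ++ (m₂ ++ (p₃ ++ e₃ :: q₃ ++ m₄)) =
          p₁ ++ ((e₁ :: (q₁ ++ m₂ ++ p₃ ++ [e₃])) ++ (q₃ ++ m₄)) := by simp
      rw [hlist] at hch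
      have hstep' := apply_eq_add_count D.src w F _ e₁ e₃ hch.right_of_append.left_of_append
      have hb' := List.count_pos_iff.2 hb
      have hd' := List.count_pos_iff.2 hd
      simp only [List.map_cons, List.map_append, List.count_cons, List.count_append] at hcount' hstep'
      -- Of the two visits to `w`, one lies in `m₂` and the other in `m₄`, so exactly one falls
      -- between `e₁` and `e₃`.
      have hone : (q₁.map D.src).count w + (m₂.map D.src).count w + (p₃.map D.src).count w = 1 := by
        simp only [beq_iff_eq, hv₁, hv₃, hw, if_false] at hcount'
        omega
      rw [hone, hv₃, if_neg hw] at hstep'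
      have hne' : F e₃ ≠ F e₁ := by
        rw [hstep']
        simp
      rcases (hs' y e₁).1 hv₁ with rfl | rfl <;> rcases (hs' _ e₃).1 hv₃ with rfl | rfl
      · exact absurd rfl hne
      · exact hne'
      · exact hne'.symm
      · exact absurd rfl hne
    · intro hne
      rw [if_neg hw, add_zero] at hstep
      simp only [beq_iff_eq, hw, if_false, add_zero] at hcount
      have hone : (l₁.map D.src).count w = 1 := by
        have h0 : (l₁.map D.src).count w ≠ 0 := by
          intro h0
          rw [h0, Nat.cast_zero, add_zero] at hstep
          exact hne hstep
        have h2 : (l₁.map D.src).count w ≠ 2 := by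
          intro h2
          rw [h2, Nat.cast_ofNat, Interlace.two_eq_zero_zmod, add_zero] at hstep
          exact hne hstep
        omega
      refine ⟨hw, _, rfl, ?_⟩
      rw [List.map_cons, List.map_append, List.map_cons, hsrc]
      have m₁ : w ∈ l₁.map D.src := List.count_pos_iff.1 (by omega)
      have m₂ : w ∈ l₂.map D.src := List.count_pos_iff.1 (by omega)
      exact ((List.singleton_sublist.2 m₁).append
        ((List.singleton_sublist.2 m₂).cons_cons (D.src y))).cons_cons (D.src y)
  rw [if_neg hw, add_zero]
  by_cases hF' : F (s y) = F y
  · rw [if_neg (fun h => hiff.1 h hF'), hF']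
    linear_combination F y * Interlace.two_eq_zero_zmod
  · rw [if_pos (hiff.2 hF')]
    revert hF'
    generalize F (s y) = a
    generalize F y = b
    revert a b
    decide

end Words

theorem IsEulerCircuit.exists_perm [Fintype E] {D : MultiDigraph V E} {C : Cycle E}
    (hC : D.IsEulerCircuit C) :
    ∃ σ : Equiv.Perm E, D.IsTransition σ ∧ ∀ e, periodicOrbit σ e = C := by
  have hP : D.IsCircuitPartition {C} :=
    ⟨by simpa using hC.isCircuit, fun e => ⟨C, by simpa using hC.mem e, by simp⟩⟩
  obtain ⟨σ, hσ, h⟩ := hP.exists_perm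
  refine ⟨σ, hσ, fun e => ?_⟩
  have he : periodicOrbit σ e ∈ orbitCycles σ := mem_orbitCycles.2 ⟨e, rfl⟩
  rwa [h, Finset.mem_singleton] at he

/-- Along a cyclic permutation, increments with zero sum have a potential. -/
theorem exists_potential [Fintype E] {σ : Equiv.Perm E} {C : Cycle E}
    (hσ : ∀ e, periodicOrbit σ e = C) (e₀ : E) (h : E → ZMod 2) (hsum : ∑ e, h e = 0) :
    ∃ F : E → ZMod 2, F e₀ = 0 ∧ ∀ e, F (σ e) = F e + h (σ e) := by
  classical
  have hper := perm_mem_periodicPts σ e₀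
  set N := minimalPeriod σ e₀ with hN
  have hNpos : 0 < N := minimalPeriod_pos_of_mem_periodicPts hper
  have hex : ∀ e, ∃ i < N, σ^[i] e₀ = e := by
    intro e
    have he : e ∈ periodicOrbit σ e₀ := by
      rw [hσ e₀, ← hσ e]
      exact self_mem_periodicOrbit_perm σ e
    obtain ⟨n, rfl⟩ := (mem_periodicOrbit_iff hper).1 he
    exact ⟨n % N, Nat.mod_lt _ hNpos, iterate_mod_minimalPeriod_eq⟩
  choose idx hlt hidx using hex
  have huniq : ∀ i < N, idx (σ^[i] e₀) = i := fun i hi =>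
    (iterate_eq_iterate_iff_of_lt_minimalPeriod (hlt _) hi).1 (hidx _)
  have htotal : ∑ i ∈ Finset.range N, h (σ^[i] e₀) = 0 := by
    rw [← hsum]
    refine Finset.sum_nbij' (fun i => σ^[i] e₀) idx ?_ ?_ ?_ ?_ ?_
    · exact fun i _ => Finset.mem_univ _
    · exact fun e _ => Finset.mem_range.2 (hlt e)
    · exact fun i hi => huniq i (Finset.mem_range.1 hi)
    · exact fun e _ => hidx e
    · exact fun i _ => rfl
  -- The potential is the partial sum of the increments on the way from `e₀` to `e`.
  refine ⟨fun e => ∑ i ∈ Finset.range (idx e), h (σ^[i + 1] e₀), ?_, fun e => ?_⟩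
  · have := huniq 0 hNpos
    rw [iterate_zero_apply] at this
    simp [this]
  dsimp only
  have hs : σ^[idx e + 1] e₀ = σ e := by rw [iterate_succ_apply', hidx]
  rw [← hs, ← Finset.sum_range_succ (fun i => h (σ^[i + 1] e₀))]
  by_cases hlast : idx e + 1 < N
  · rw [huniq _ hlast]
  -- At the return to `e₀` the sum runs over the whole cycle; this is where the total must vanish.
  have hlast' : idx e + 1 = N := by have := hlt e; omega
  have h0 : σ^[N] e₀ = e₀ := iterate_minimalPeriod
  have hi0 := huniq 0 hNpos
  rw [iterate_zero_apply] at hi0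
  rw [hlast', h0, hi0, Finset.sum_range_zero]
  have h1 := Finset.sum_range_succ (fun i => h (σ^[i] e₀)) N
  rw [Finset.sum_range_succ', htotal, h0, iterate_zero_apply, zero_add] at h1
  exact (add_eq_right.1 h1).symm

open Classical in
/-- The permutation that exchanges the two edges with tail `v` for every `v` in `S`. -/
noncomputable def swapPerm (D : MultiDigraph V E) {s : E → E} (hs : ∀ e, s e ≠ e)
    (hs' : ∀ e f, D.src f = D.src e ↔ f = e ∨ f = s e) (S : Finset V) : Equiv.Perm E :=
  Involutive.toPerm (fun e => if D.src e ∈ S then s e else e) (by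
    intro e
    by_cases h : D.src e ∈ S <;> simp [h, src_swap hs', swap_swap hs hs'])

section Transition

variable {D : MultiDigraph V E} {s : E → E} (hs : ∀ e, s e ≠ e)
  (hs' : ∀ e f, D.src f = D.src e ↔ f = e ∨ f = s e)

theorem swapPerm_of_mem {S : Finset V} {e : E} (h : D.src e ∈ S) :
    swapPerm D hs hs' S e = s e :=
  if_pos h

theorem swapPerm_of_notMem {S : Finset V} {e : E} (h : D.src e ∉ S) :
    swapPerm D hs hs' S e = e :=
  if_neg h

theorem src_swapPerm (S : Finset V) (e : E) : D.src (swapPerm D hs hs' S e) = D.src e := by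
  by_cases h : D.src e ∈ S
  · rw [swapPerm_of_mem hs hs' h, src_swap hs']
  · rw [swapPerm_of_notMem hs hs' h]

-- Two transition permutations differ by a permutation preserving tails, which at each vertex either
-- fixes or swaps its two outgoing edges.
open Classical in
theorem sum_isTransition [Fintype V] [Fintype E] (hD : D.IsTwoInTwoOut) {σ : Equiv.Perm E}
    (hσ : D.IsTransition σ) {M : Type*} [AddCommMonoid M] (φ : Equiv.Perm E → M) :
    ∑ π : Equiv.Perm E with D.IsTransition π, φ π =
      ∑ S : Finset V, φ (swapPerm D hs hs' S * σ) := by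
  symm
  refine Finset.sum_bij (fun S _ => swapPerm D hs hs' S * σ) ?_ ?_ ?_ ?_
  · intro S _
    rw [Finset.mem_filter]
    refine ⟨Finset.mem_univ _, fun e => ?_⟩
    rw [Equiv.Perm.mul_apply, src_swapPerm]
    exact hσ e
  · intro S _ T _ h
    have h' := mul_right_cancel h
    have key : ∀ S : Finset V, ∀ e, D.src e ∈ S ↔ swapPerm D hs hs' S e ≠ e := by
      intro S e
      by_cases he : D.src e ∈ S
      · simp [swapPerm_of_mem hs hs' he, he, hs e]
      · simp [swapPerm_of_notMem hs hs' he, he]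
    ext v
    obtain ⟨e, rfl⟩ := hD.exists_src_eq v
    rw [key S, key T, h']
  · intro π hπ
    have hπ : D.IsTransition π := (Finset.mem_filter.1 hπ).2
    have hsrc : ∀ e, D.src (π (σ⁻¹ e)) = D.src e := by
      intro e
      rw [← hπ, hσ, show σ (σ⁻¹ e) = e from σ.apply_symm_apply e]
    refine ⟨Finset.univ.filter fun v => ∃ e, D.src e = v ∧ π (σ⁻¹ e) ≠ e, Finset.mem_univ _, ?_⟩
    rw [← eq_mul_inv_iff_mul_eq]
    ext e
    rw [Equiv.Perm.mul_apply]
    by_cases he : ∃ f, D.src f = D.src e ∧ π (σ⁻¹ f) ≠ f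
    · rw [swapPerm_of_mem hs hs' (by simpa using he)]
      obtain ⟨f, hf, hne⟩ := he
      have hfs := ((hs' f _).1 (hsrc f)).resolve_left hne
      rcases (hs' f e).1 hf.symm with rfl | rfl
      · exact hfs.symm
      -- If one of the two edges moves, so does the other, by injectivity.
      rcases (hs' (s f) _).1 (hsrc (s f)) with h | h
      · exact absurd (σ⁻¹.injective (π.injective (h.trans hfs.symm))) (hs f)
      · exact h.symm
    · rw [swapPerm_of_notMem hs hs' (by simpa using he)]
      push Not at he
      exact (he e rfl).symm
  · intro S _
    rfl

end Transition

end MultiDigraph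

/-! ### Cycles of a transition permutation and nullity -/

namespace MultiDigraph

open Function

variable {V E : Type*}

/-- The transition permutation obtained from an Euler circuit by changing the transitions at `S`
has one cycle more than the nullity of the interlace graph on `S`. -/
theorem card_orbitCycles_swapPerm_mul [Fintype V] [Fintype E] {D : MultiDigraph V E}
    (hD : D.IsTwoInTwoOut) {C : Cycle E} (hC : D.IsEulerCircuit C) {s : E → E}
    (hs : ∀ e, s e ≠ e) (hs' : ∀ e f, D.src f = D.src e ↔ f = e ∨ f = s e) {σ : Equiv.Perm E}
    (hσ : ∀ e, periodicOrbit σ e = C) (S : Finset V) :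
    (orbitCycles (swapPerm D hs hs' S * σ)).card =
      1 + Interlace.nullity (D.interlaceGraph C) S := by
  classical
  obtain ⟨e₀, -⟩ := hC.isCircuit.exists_mem
  have hsurj : ∀ v, ∃ e, D.src (σ e) = v := by
    intro v
    obtain ⟨e, he⟩ := hD.exists_src_eq v
    exact ⟨σ.symm e, by rw [σ.apply_symm_apply]; exact he⟩
  -- The jumps at `w` sum to zero because exactly two edges have tail `w`.
  have hpot : ∀ w, ∃ F : E → ZMod 2, F e₀ = 0 ∧
      ∀ e, F (σ e) = F e + if D.src (σ e) = w then 1 else 0 := by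
    intro w
    refine exists_potential hσ e₀ (fun e => if D.src e = w then 1 else 0) ?_
    rw [Finset.sum_boole, ← Set.ncard_coe_finset]
    have h2 := (hD w).2
    simp only [Finset.coe_filter, Finset.mem_univ, true_and, h2]
    exact Interlace.two_eq_zero_zmod
  choose F hF₀ hF using hpot
  have hswap : ∀ w y, F w y + F w (s y) =
      (D.interlaceGraph C).adjMatrix (ZMod 2) (D.src y) w + if D.src y = w then 1 else 0 := by
    intro w y
    rw [SimpleGraph.adjMatrix_apply]
    refine potential_add_swap hD hC hs hs' ?_ y
    rw [← hσ y, periodicOrbit_chain' _ (perm_mem_periodicPts σ y)]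
    intro n
    rw [iterate_succ_apply']
    exact hF w _
  have hunique : ∀ f f' : E → ZMod 2, f e₀ = f' e₀ →
      ∀ h : E → ZMod 2, (∀ e, f (σ e) = f e + h e) → (∀ e, f' (σ e) = f' e + h e) → f = f' := by
    intro f f' h0 h hf hf'
    funext e
    have he : e ∈ periodicOrbit σ e₀ := by
      rw [hσ e₀, ← hσ e]
      exact self_mem_periodicOrbit_perm σ e
    obtain ⟨n, rfl⟩ := (mem_periodicOrbit_iff (perm_mem_periodicPts σ e₀)).1 he
    induction n with
    | zero => exact h0
    | succ n ih =>
      have hmem : σ^[n] e₀ ∈ periodicOrbit σ e₀ :=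
        iterate_mem_periodicOrbit (perm_mem_periodicPts σ e₀) n
      rw [iterate_succ_apply', hf, hf', ih hmem]
  -- The function on edges with value `c` at `e₀` that jumps by `g v` on each arrival at `v` along
  -- `C`.
  let Φ : ZMod 2 → (V → ZMod 2) → E → ZMod 2 := fun c g e => c + ∑ w, F w e * g w
  have hΦ₀ : ∀ c g, Φ c g e₀ = c := by
    intro c g
    simp [Φ, hF₀]
  have hΦσ : ∀ c g e, Φ c g (σ e) = Φ c g e + g (D.src (σ e)) := by
    intro c g e
    simp [Φ, hF, add_mul, Finset.sum_add_distrib, add_assoc]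
  -- With `A` the interlace matrix, the values at the two edges with tail `v` differ by `(A g) v + g
  -- v`.
  have hΦs : ∀ c g y, Φ c g y + Φ c g (s y) =
      ∑ w, (D.interlaceGraph C).adjMatrix (ZMod 2) (D.src y) w * g w + g (D.src y) := by
    intro c g y
    have h1 : Φ c g y + Φ c g (s y) = ∑ w, (F w y + F w (s y)) * g w + c * 2 := by
      simp only [Φ, add_mul, Finset.sum_add_distrib]
      ring
    rw [h1, Interlace.two_eq_zero_zmod, mul_zero, add_zero]
    simp only [hswap, add_mul, Finset.sum_add_distrib, ite_mul, one_mul, zero_mul,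
      Finset.sum_ite_eq, Finset.mem_univ, if_true]
  -- At a swapped vertex `v` the jump `g v` cancels, leaving the condition `(A g) v = 0`; at any
  -- other vertex the condition is `g v = 0`.
  have hmem : ∀ c, ∀ g ∈ Interlace.adjKernel (D.interlaceGraph C) S,
      Φ c g ∈ invariants (swapPerm D hs hs' S * σ) := by
    intro c g hg e
    rw [Interlace.mem_adjKernel] at hg
    rw [Equiv.Perm.mul_apply]
    have h1 := hΦσ c g e
    by_cases he : D.src (σ e) ∈ S
    · rw [swapPerm_of_mem hs hs' he]
      have h2 := hΦs c g (σ e)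
      rw [hg.2 _ he] at h2
      linear_combination h2 - h1 - Φ c g e * Interlace.two_eq_zero_zmod
    · rw [swapPerm_of_notMem hs hs' he, h1, hg.1 _ he, add_zero]
  have e : ZMod 2 × Interlace.adjKernel (D.interlaceGraph C) S ≃
      invariants (swapPerm D hs hs' S * σ) := by
    refine Equiv.ofBijective (fun p => ⟨Φ p.1 p.2.1, hmem p.1 p.2.1 p.2.2⟩) ⟨?_, ?_⟩
    · rintro ⟨c, g, hg⟩ ⟨c', g', hg'⟩ h
      have h : Φ c g = Φ c' g' := Subtype.ext_iff.1 h
      have hc : c = c' := by rw [← hΦ₀ c g, h, hΦ₀]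
      have hgg : g = g' := by
        funext v
        obtain ⟨e, rfl⟩ := hsurj v
        have h1 := hΦσ c g e
        rw [h, hΦσ] at h1
        exact (add_left_cancel h1).symm
      subst hc hgg
      rfl
    · rintro ⟨f, hf⟩
      -- For invariant `f`, the jump at a vertex of `S` is the difference between its two outgoing
      -- edges, whichever of them is chosen, since the edge before `σ e` shares its value with `s (σ
      -- e)`.
      let g : V → ZMod 2 := fun v =>
        if v ∈ S then f (σ (hsurj v).choose) + f (s (σ (hsurj v).choose)) else 0
      have hgS : ∀ y, D.src y ∈ S → g (D.src y) = f y + f (s y) := by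
        intro y hy
        have h1 : g (D.src y) = _ := if_pos hy
        rw [h1]
        rcases (hs' y _).1 (hsurj (D.src y)).choose_spec with h | h
        · rw [h]
        · rw [h, swap_swap hs hs', add_comm]
      have hgn : ∀ v, v ∉ S → g v = 0 := fun v hv => if_neg hv
      have hfσ : ∀ e, f (σ e) = f e + g (D.src (σ e)) := by
        intro e
        have h := hf e
        rw [Equiv.Perm.mul_apply] at h
        by_cases he : D.src (σ e) ∈ S
        · rw [swapPerm_of_mem hs hs' he] at h
          rw [hgS _ he, h]
          linear_combination (-f e) * Interlace.two_eq_zero_zmod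
        · rw [swapPerm_of_notMem hs hs' he] at h
          rw [hgn _ he, h, add_zero]
      have hfΦ : Φ (f e₀) g = f :=
        hunique _ _ (hΦ₀ _ _) (fun e => g (D.src (σ e))) (hΦσ _ _) hfσ
      refine ⟨⟨f e₀, g, ?_⟩, Subtype.ext hfΦ⟩
      rw [Interlace.mem_adjKernel]
      refine ⟨hgn, fun v hv => ?_⟩
      obtain ⟨e, rfl⟩ := hsurj v
      have h1 := hΦs (f e₀) g (σ e)
      rw [hfΦ, ← hgS _ hv] at h1
      exact right_eq_add.1 h1
  rw [← finrank_invariants, ← Interlace.finrank_eq_of_equiv e, Module.finrank_prod,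
    Module.finrank_self, Interlace.nullity]

/-- The circuit partition polynomial as a sum over the sets of vertices at which the transitions
differ from those of an Euler circuit. -/
theorem circuitPartitionPoly_eq_sum_nullity [Fintype V] [Fintype E] {D : MultiDigraph V E}
    (hD : D.IsTwoInTwoOut) {C : Cycle E} (hC : D.IsEulerCircuit C) :
    D.circuitPartitionPoly =
      ∑ S : Finset V, X ^ (1 + Interlace.nullity (D.interlaceGraph C) S) := by
  classical
  obtain ⟨s, hs, hs'⟩ := hD.exists_swap
  obtain ⟨σ, hσ, hσC⟩ := hC.exists_perm
  rw [circuitPartitionPoly_eq_sum, sum_isTransition hs hs' hD hσ]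
  exact Finset.sum_congr rfl fun S _ => by rw [card_orbitCycles_swapPerm_mul hD hC hs hs' hσC]

end MultiDigraph

/-! ### Comparison of the two expansions -/

theorem theorem24 {V E : Type*} [Finite V] [Finite E] (D : MultiDigraph V E)
    (hD : D.IsTwoInTwoOut) (C : Cycle E) (hC : D.IsEulerCircuit C) :
    (algebraMap ℤ[X] (RatFunc ℤ) (Interlace.interlacePoly (D.interlaceGraph C)) =
        algebraMap ℤ[X] (RatFunc ℤ) (D.circuitPartitionPoly.comp (X - 1)) /
          algebraMap ℤ[X] (RatFunc ℤ) (X - 1) ∧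
      algebraMap ℤ[X] (RatFunc ℤ) (D.circuitPartitionPoly.comp (X - 1)) /
          algebraMap ℤ[X] (RatFunc ℤ) (X - 1) = D.martin) ∧
    X * (Interlace.interlacePoly (D.interlaceGraph C)).comp (1 + X) = D.circuitPartitionPoly := by
  cases nonempty_fintype V
  cases nonempty_fintype E
  have hr := MultiDigraph.circuitPartitionPoly_eq_sum_nullity hD hC
  have hq := Interlace.interlacePoly_eq_sum (D.interlaceGraph C)
  refine ⟨⟨?_, rfl⟩, ?_⟩
  · have hne : algebraMap ℤ[X] (RatFunc ℤ) (X - 1) ≠ 0 := by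
      rw [ne_eq, FaithfulSMul.algebraMap_eq_zero_iff]
      simpa using X_sub_C_ne_zero (1 : ℤ)
    rw [eq_div_iff hne, ← map_mul]
    congr 1
    rw [hr, hq, Polynomial.sum_comp, Finset.sum_mul]
    refine Finset.sum_congr rfl fun S _ => ?_
    rw [X_pow_comp, pow_add, pow_one, mul_comm]
  · rw [hr, hq, Polynomial.sum_comp, Finset.mul_sum]
    refine Finset.sum_congr rfl fun S _ => ?_
    rw [pow_comp, sub_comp, X_comp, one_comp, add_sub_cancel_left, pow_add, pow_one]
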